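/- There exist absolute constants $C_1,C_2>0$ such that the following holds. Let $n\ge 2$, let $x\ge 1$ be an integer, let $C_0\ge 1$ be real, and let $X_1,\dots,X_n$ be identically distributed, non-negative integer-valued random variables that are 1-dependent, i.e. for all $1\le s<t\le n$ with $t-s>1$ the $\sigma$-algebras generated by $X_1,\dots,X_s$ and by $X_t,\dots,X_n$ are independent. Put $S_n=X_1+\dots+X_n$, $$\nu_1=\mathbb E X_1,\qquad \nu_2=\mathbb E X_1(X_1-1),\qquad y=\frac{x-n\nu_1}{n\nu_1},\qquad \gamma=e^{1.5C_0}\max(\nu_1^2,\nu_2,\mathbb E X_1X_2),$$ $$\Lambda(y)=-n(1-\nu_1)\sum_{j=2}^\infty\Big(\frac{\nu_1}{1-\nu_1}\Big)^j\frac{y^j}{j(j-1)} .$$ Assume that $\nu_1>0$, that $\mathbb E X_jX_{j+1}\le \mathbb E X_1X_2$ for all $1\le j<n$ (which holds in particular if $\mathbb E X_jX_{j+1}$ does not depend on $j$), and that $$X_1\le C_0 \text{ almost surely},\qquad e^{5C_0}\nu_1\le 0.002,\qquad |y|\le \tfrac1{10},$$ $$\nu_2\le \frac{\nu_1e^{-1.5C_0}}{20},\qquad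 \mathbb E X_1X_2\le\frac{\nu_1e^{-1.5C_0}}{20}.$$ Let $Z_n$ be a Poisson random variable with parameter $n\nu_1$. Then $$\frac{P(S_n=x)}{P(Z_n=x)}=e^{\Lambda(y)}\,(1+C_1\gamma y^2)^n\,\Big(1+\theta C_2\gamma\big(\nu_1^{-1}+ny^2\big)\Big)$$ for some real number $\theta$ with $|\theta|\le 1$. -/

import Mathlib

open MeasureTheory ProbabilityTheory

noncomputable section

/-- The random variables `X 1, …, X n` are `m`-dependent: whenever `1 ≤ s`, `t ≤ n` and
`t - s > m`, the sigma-algebras generated by `X 1, …, X s` and by `X t, …, X n` are independent.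
Only the variables with index in `{1, …, n}` matter. -/
def IsMDependent {Ω : Type*} [MeasurableSpace Ω] (m n : ℕ) (X : ℕ → Ω → ℕ) (P : Measure Ω) :
    Prop :=
  ∀ s t : ℕ, 1 ≤ s → s + m < t → t ≤ n →
    Indep (⨆ i ∈ Set.Icc 1 s, MeasurableSpace.comap (X i) ⊤)
      (⨆ i ∈ Set.Icc t n, MeasurableSpace.comap (X i) ⊤) P

/-- The Cramér-type series
`Λ(y) = -n (1 - ν₁) ∑_{j ≥ 2} (ν₁ / (1 - ν₁)) ^ j * y ^ j / (j (j - 1))`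
(the summation index is shifted by two). -/
def cramerSeries (n : ℕ) (ν₁ y : ℝ) : ℝ :=
  -(n : ℝ) * (1 - ν₁) *
    ∑' k : ℕ, (ν₁ / (1 - ν₁)) ^ (k + 2) * (y ^ (k + 2) / (((k : ℝ) + 2) * ((k : ℝ) + 1)))

end

/-! Write R for the ratio of the two point probabilities. The factors `exp Λ` and `(1 + C₁γy²)^n`
are both of size exp(O(nγy²)), so it suffices to show |R - 1| ≤ c(γ/ν₁ + nγy²)exp(c'nγy²); a large
enough C₁ lets the prefactor absorb the exponential (`abs_sub_correction_le`).

To bound R - 1, both probabilities are recovered by Cauchy's formula on the circle of radius r = 1 +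
y = x/(nν₁), the saddle point of the Poisson integrand. There the generating functions differ by
about nε|z-1|² times the size of the Poisson one, with ε = O(γ)
(`norm_integral_pow_sum_sub_exp_le`). Since |z-1|² = y² + 2r(1 - cos t) and the integrand decays
like a Gaussian of variance 1/(nν₁), integration turns this into nεy² + ε/ν₁, relative to a Poisson
probability bounded below by Stirling (`abs_measureReal_div_poisson_sub_one_le`).

The generating function is f_n, where f_k = E ∏_{i≤k}(1 + G(X_i)) and G(j) = z^j - 1. Expanding only
the last factors and using 1-dependence shows that f_{k+1}/f_k is close to 1 + E G(X_1), hence to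
exp(ν₁(z-1)). All errors are kept relative to |f_k|, so they multiply up harmlessly
(`norm_integral_onePlusProd_succ_sub_le`, `norm_sub_pow_le_of_step`). -/

/-! ### Fourier inversion on a circle. -/

theorem intervalIntegral_exp_int_mul {m : ℤ} (hm : m ≠ 0) :
    ∫ t in (-Real.pi)..Real.pi, Complex.exp ((m * Complex.I) * (t : ℂ)) = 0 := by
  have hc : (m : ℂ) * Complex.I ≠ 0 := mul_ne_zero (by exact_mod_cast hm) Complex.I_ne_zero
  rw [integral_exp_mul_complex hc]
  have : Complex.exp ((m * Complex.I) * (Real.pi : ℝ)) =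
      Complex.exp ((m * Complex.I) * ((-Real.pi : ℝ) : ℂ)) := by
    rw [Complex.exp_eq_exp_iff_exists_int]
    exact ⟨m, by push_cast; ring⟩
  rw [this, sub_self, zero_div]

theorem intervalIntegral_pow_mul_exp (r : ℝ) (k x : ℕ) :
    ∫ t in (-Real.pi)..Real.pi,
      ((r : ℂ) * Complex.exp (t * Complex.I)) ^ k * Complex.exp (-(x * (t * Complex.I))) =
      if k = x then (2 * Real.pi * r ^ x : ℂ) else 0 := by
  have key : ∀ t : ℝ, ((r : ℂ) * Complex.exp (t * Complex.I)) ^ k *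
      Complex.exp (-(x * (t * Complex.I))) =
      (r : ℂ) ^ k * Complex.exp ((((k : ℤ) - x : ℤ) * Complex.I) * (t : ℂ)) := by
    intro t
    rw [mul_pow, ← Complex.exp_nat_mul, mul_assoc, ← Complex.exp_add]
    congr 2
    push_cast
    ring
  simp_rw [key]
  rw [intervalIntegral.integral_const_mul]
  split_ifs with h
  · subst h
    simp
    ring
  · rw [intervalIntegral_exp_int_mul (by omega), mul_zero]

/-- Fourier inversion on the circle of radius `r` for the law of a natural-valued variable. -/
theorem two_pi_mul_measureReal_eq {Ω : Type*} [MeasurableSpace Ω] (P : Measure Ω)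
    [IsFiniteMeasure P] {S : Ω → ℕ} (hS : Measurable S) {r : ℝ} (hr : 0 < r)
    (hint : Integrable (fun ω => r ^ S ω) P) (x : ℕ) :
    ((2 * Real.pi * r ^ x * P.real {ω | S ω = x} : ℝ) : ℂ) =
      ∫ t in (-Real.pi)..Real.pi,
        (∫ ω, ((r : ℂ) * Complex.exp (t * Complex.I)) ^ S ω ∂P) *
          Complex.exp (-(x * (t * Complex.I))) := by
  simp_rw [← integral_mul_const]
  rw [intervalIntegral.integral_of_le (by linarith [Real.pi_pos]), integral_integral_swap]
  · simp_rw [← intervalIntegral.integral_of_le (show -Real.pi ≤ Real.pi by linarith [Real.pi_pos]),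
      intervalIntegral_pow_mul_exp]
    have hm : MeasurableSet {ω | S ω = x} := hS (measurableSet_singleton x)
    have : (fun ω => if S ω = x then (2 * Real.pi * r ^ x : ℂ) else 0) =
        {ω | S ω = x}.indicator (fun _ => (2 * Real.pi * r ^ x : ℂ)) := by
      ext ω
      simp [Set.indicator]
    rw [this, integral_indicator hm, setIntegral_const]
    simp
    ring
  · have hb : Integrable (fun p : ℝ × Ω => (1 : ℝ) * r ^ S p.2)
        ((volume.restrict (Set.Ioc (-Real.pi) Real.pi)).prod P) :=
      (integrable_const (1 : ℝ)).mul_prod hint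
    refine hb.mono' ?_ (Filter.Eventually.of_forall fun p => ?_)
    · have h1 : Measurable (fun p : ℝ × Ω => S p.2) := hS.comp measurable_snd
      have h2 : Measurable (fun p : ℝ × Ω => (r : ℂ) * Complex.exp (p.1 * Complex.I)) := by
        fun_prop
      have h3 : Measurable (fun p : ℝ × Ω => Complex.exp (-(x * (p.1 * Complex.I)))) := by
        fun_prop
      exact ((h2.pow h1).mul h3).aestronglyMeasurable
    · simp only [Function.uncurry, norm_mul, norm_pow, Complex.norm_exp_ofReal_mul_I]
      rw [show -((x : ℂ) * (p.1 * Complex.I)) = ((-(x * p.1) : ℝ) : ℂ) * Complex.I by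
        push_cast; ring, Complex.norm_exp_ofReal_mul_I]
      simp [abs_of_pos hr]

/-! ### The Poisson generating function and a Stirling bound. -/

theorem hasSum_poissonMeasure_pow (l : NNReal) (z : ℂ) :
    HasSum (fun k : ℕ => (Real.exp (-l) * l ^ k / k.factorial) • z ^ k)
      (Complex.exp (l * (z - 1))) := by
  have h := (NormedSpace.expSeries_div_hasSum_exp ((l : ℂ) * z)).mul_left (Complex.exp (-l))
  rw [← Complex.exp_eq_exp_ℂ, ← Complex.exp_add] at h
  have h1 : (l : ℂ) * (z - 1) = -l + l * z := by ring
  have h2 : (fun k : ℕ => (Real.exp (-l) * l ^ k / k.factorial) • z ^ k) =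
      fun k : ℕ => Complex.exp (-l) * ((l * z) ^ k / k.factorial) := by
    ext k
    rw [Complex.real_smul]
    push_cast
    ring
  rw [h1, h2]
  exact h

theorem integral_pow_poissonMeasure (l : NNReal) (z : ℂ) :
    ∫ k, z ^ k ∂(poissonMeasure l) = Complex.exp (l * (z - 1)) := by
  rw [integral_poissonMeasure]
  exact (hasSum_poissonMeasure_pow l z).tsum_eq

theorem integrable_pow_poissonMeasure (l : NNReal) (r : ℝ) :
    Integrable (fun k : ℕ => r ^ k) (poissonMeasure l) := by
  rw [integrable_poissonMeasure_iff]
  have h := (NormedSpace.expSeries_div_summable (l * |r|)).mul_left (Real.exp (-l))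
  refine h.congr fun k => ?_
  simp only [norm_pow, Real.norm_eq_abs]
  rw [mul_pow]
  ring

/-- The Stirling sequence decreases from its value e/√2 at 1. -/
theorem factorial_le_stirling {x : ℕ} (hx : 1 ≤ x) :
    (x.factorial : ℝ) ≤ Real.exp 1 * √x * (x / Real.exp 1) ^ x := by
  obtain ⟨k, rfl⟩ := Nat.exists_eq_succ_of_ne_zero (by omega : x ≠ 0)
  have h : Stirling.stirlingSeq (k + 1) ≤ Stirling.stirlingSeq 1 :=
    Stirling.stirlingSeq'_antitone (Nat.zero_le k)
  rw [Stirling.stirlingSeq_one, Stirling.stirlingSeq, div_le_iff₀ (by positivity)] at h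
  refine h.trans (le_of_eq ?_)
  rw [Real.sqrt_mul (by norm_num)]
  field_simp

/-! ### Products over blocks of 1-dependent variables. -/

/-- The sigma-algebra generated by `X s, …, X t`. -/
abbrev blockSigma {Ω : Type*} (X : ℕ → Ω → ℕ) (s t : ℕ) : MeasurableSpace Ω :=
  ⨆ i ∈ Set.Icc s t, MeasurableSpace.comap (X i) ⊤

theorem measurable_blockSigma_comp {Ω : Type*} (X : ℕ → Ω → ℕ) {β : Type*} [MeasurableSpace β]
    (h : ℕ → β) {s t i : ℕ} (hs : s ≤ i) (ht : i ≤ t) :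
    Measurable[blockSigma X s t] (fun ω => h (X i ω)) := by
  have h1 : Measurable[MeasurableSpace.comap (X i) ⊤] (fun ω => h (X i ω)) :=
    (measurable_from_top (f := h)).comp (comap_measurable (X i))
  exact h1.mono (le_iSup₂_of_le i ⟨hs, ht⟩ le_rfl) le_rfl

theorem blockSigma_le {Ω : Type*} [m0 : MeasurableSpace Ω] {X : ℕ → Ω → ℕ} {s t : ℕ}
    (hX : ∀ i ∈ Finset.Icc s t, Measurable (X i)) : blockSigma X s t ≤ m0 :=
  iSup₂_le fun i hi => (hX i (Finset.mem_Icc.2 hi)).comap_le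

theorem integral_mul_of_indep {Ω 𝕜 : Type*} [RCLike 𝕜] [m0 : MeasurableSpace Ω] {P : Measure Ω}
    {m1 m2 : MeasurableSpace Ω} (h1 : m1 ≤ m0) (h2 : m2 ≤ m0) (hI : Indep m1 m2 P)
    {U V : Ω → 𝕜} (hU : Measurable[m1] U) (hV : Measurable[m2] V) :
    ∫ ω, U ω * V ω ∂P = (∫ ω, U ω ∂P) * ∫ ω, V ω ∂P := by
  have hUV : IndepFun U V P := by
    rw [IndepFun_iff_Indep]
    exact indep_of_indep_of_le_left (indep_of_indep_of_le_right hI hV.comap_le) hU.comap_le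
  exact hUV.integral_fun_mul_eq_mul_integral (hU.mono h1 le_rfl).aestronglyMeasurable
    (hV.mono h2 le_rfl).aestronglyMeasurable

/-- The product of `1 + G (X i)` over `1 ≤ i ≤ k`. -/
def onePlusProd {Ω : Type*} (X : ℕ → Ω → ℕ) (G : ℕ → ℂ) (k : ℕ) (ω : Ω) : ℂ :=
  ∏ i ∈ Finset.Icc 1 k, (1 + G (X i ω))

/-- The product of `G (X i)` over `k < i ≤ k + m`. -/
def blockProd {Ω : Type*} (X : ℕ → Ω → ℕ) (G : ℕ → ℂ) (k m : ℕ) (ω : Ω) : ℂ :=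
  ∏ i ∈ Finset.range m, G (X (k + 1 + i) ω)

section

variable {Ω : Type*} {X : ℕ → Ω → ℕ} {G : ℕ → ℂ}

theorem onePlusProd_zero (ω : Ω) : onePlusProd X G 0 ω = 1 := by simp [onePlusProd]

theorem onePlusProd_succ (k : ℕ) (ω : Ω) :
    onePlusProd X G (k + 1) ω = onePlusProd X G k ω * (1 + G (X (k + 1) ω)) := by
  rw [onePlusProd, Finset.prod_Icc_succ_top (by omega)]; rfl

theorem blockProd_succ_left (k m : ℕ) (ω : Ω) :
    blockProd X G k (m + 1) ω = G (X (k + 1) ω) * blockProd X G (k + 1) m ω := by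
  rw [blockProd, Finset.prod_range_succ', mul_comm, blockProd]
  congr 1
  exact Finset.prod_congr rfl fun i _ => by rw [show k + 1 + (i + 1) = k + 1 + 1 + i by ring]

theorem blockProd_succ_right (k m : ℕ) (ω : Ω) :
    blockProd X G k (m + 1) ω = blockProd X G k m ω * G (X (k + 1 + m) ω) :=
  Finset.prod_range_succ _ _

theorem measurable_onePlusProd (k : ℕ) :
    Measurable[blockSigma X 1 k] (onePlusProd X G k) := by
  unfold onePlusProd
  refine @Finset.measurable_fun_prod _ _ _ _ _ _ (blockSigma X 1 k) _ _ fun i hi => ?_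
  exact measurable_blockSigma_comp X (fun j => 1 + G j) (Finset.mem_Icc.1 hi).1
    (Finset.mem_Icc.1 hi).2

theorem measurable_blockProd {s t k m : ℕ} (hs : s ≤ k + 1) (ht : k + m ≤ t) :
    Measurable[blockSigma X s t] (blockProd X G k m) := by
  unfold blockProd
  refine @Finset.measurable_fun_prod _ _ _ _ _ _ (blockSigma X s t) _ _ fun i hi => ?_
  rw [Finset.mem_range] at hi
  exact measurable_blockSigma_comp X G (by omega) (by omega)

theorem norm_onePlusProd_le {M : ℝ} (hM : ∀ j, ‖G j‖ ≤ M) (k : ℕ) (ω : Ω) :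
    ‖onePlusProd X G k ω‖ ≤ (1 + M) ^ k := by
  rw [onePlusProd, norm_prod]
  refine (Finset.prod_le_prod (g := fun _ => 1 + M) (fun i _ => norm_nonneg _)
    fun i _ => ?_).trans (by simp)
  exact (norm_add_le _ _).trans (by simpa using hM _)

theorem norm_blockProd_le {M : ℝ} (hM : ∀ j, ‖G j‖ ≤ M) (k m : ℕ) (ω : Ω) :
    ‖blockProd X G k m ω‖ ≤ M ^ m := by
  rw [blockProd, norm_prod]
  exact (Finset.prod_le_prod (g := fun _ => M) (fun i _ => norm_nonneg _)
    fun i _ => hM _).trans (by simp)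

variable [m0 : MeasurableSpace Ω] {P : Measure Ω} [IsProbabilityMeasure P] {n : ℕ}

theorem measurable_onePlusProd' (hX : ∀ i ∈ Finset.Icc 1 n, Measurable (X i)) {k : ℕ}
    (hk : k ≤ n) : Measurable (onePlusProd X G k) :=
  (measurable_onePlusProd k).mono
    (blockSigma_le fun i hi => hX i (Finset.Icc_subset_Icc_right hk hi)) le_rfl

theorem measurable_blockProd' (hX : ∀ i ∈ Finset.Icc 1 n, Measurable (X i)) {k m : ℕ}
    (hk : k + m ≤ n) : Measurable (blockProd X G k m) :=
  (measurable_blockProd (s := 1) (by omega) hk).mono (blockSigma_le hX) le_rfl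

theorem integrable_onePlusProd_mul_blockProd (hX : ∀ i ∈ Finset.Icc 1 n, Measurable (X i))
    {M : ℝ} (hM : ∀ j, ‖G j‖ ≤ M) {k l m : ℕ} (hk : k ≤ n) (hl : l + m ≤ n) :
    Integrable (fun ω => onePlusProd X G k ω * blockProd X G l m ω) P := by
  refine Integrable.of_bound (C := (1 + M) ^ k * M ^ m)
    ((measurable_onePlusProd' hX hk).mul (measurable_blockProd' hX hl)).aestronglyMeasurable
    (Filter.Eventually.of_forall fun ω => ?_)
  have hM0 : 0 ≤ M := (norm_nonneg _).trans (hM 0)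
  rw [norm_mul]
  exact mul_le_mul (norm_onePlusProd_le hM _ _) (norm_blockProd_le hM l m ω) (norm_nonneg _)
    (by positivity)

theorem integral_onePlusProd_mul_blockProd_gap (hX : ∀ i ∈ Finset.Icc 1 n, Measurable (X i))
    (hdep : IsMDependent 1 n X P) {k m : ℕ} (hm : 1 ≤ m) (hk : k + 1 + m ≤ n) :
    ∫ ω, onePlusProd X G k ω * blockProd X G (k + 1) m ω ∂P =
      (∫ ω, onePlusProd X G k ω ∂P) * ∫ ω, blockProd X G (k + 1) m ω ∂P := by
  -- `IsMDependent` speaks only of left blocks ending at 1 or later, so the empty product is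
  -- separate.
  rcases Nat.eq_zero_or_pos k with rfl | hk0
  · simp [onePlusProd_zero]
  · exact integral_mul_of_indep (m1 := blockSigma X 1 k) (m2 := blockSigma X (k + 2) n)
      (blockSigma_le fun i hi => hX i (Finset.Icc_subset_Icc_right (by omega) hi))
      (blockSigma_le fun i hi => hX i (Finset.Icc_subset_Icc_left (by omega) hi))
      (hdep k (k + 2) hk0 (by omega) (by omega)) (measurable_onePlusProd k)
      (measurable_blockProd (by omega) hk)

/-- Expanding the factor 1 + G(X_{k+1}): the term 1 leaves a gap at index k + 1, so independence
applies; the term G lengthens the block to the left. This trades one step in k for one in the block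
length. -/
theorem integral_onePlusProd_mul_blockProd_succ (hX : ∀ i ∈ Finset.Icc 1 n, Measurable (X i))
    (hdep : IsMDependent 1 n X P) {M : ℝ} (hM : ∀ j, ‖G j‖ ≤ M) {k m : ℕ} (hm : 1 ≤ m)
    (hk : k + 1 + m ≤ n) :
    ∫ ω, onePlusProd X G (k + 1) ω * blockProd X G (k + 1) m ω ∂P =
      (∫ ω, onePlusProd X G k ω ∂P) * (∫ ω, blockProd X G (k + 1) m ω ∂P) +
        ∫ ω, onePlusProd X G k ω * blockProd X G k (m + 1) ω ∂P := by
  rw [← integral_onePlusProd_mul_blockProd_gap hX hdep hm hk, ← integral_add]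
  · refine integral_congr_ae (Filter.Eventually.of_forall fun ω => ?_)
    simp only [onePlusProd_succ, blockProd_succ_left]
    ring
  · exact integrable_onePlusProd_mul_blockProd hX hM (by omega) (by omega)
  · exact integrable_onePlusProd_mul_blockProd hX hM (by omega) (by omega)

theorem integral_onePlusProd_succ (hX : ∀ i ∈ Finset.Icc 1 n, Measurable (X i))
    {M : ℝ} (hM : ∀ j, ‖G j‖ ≤ M) {k : ℕ} (hk : k + 1 ≤ n) :
    ∫ ω, onePlusProd X G (k + 1) ω ∂P =
      (∫ ω, onePlusProd X G k ω ∂P) + ∫ ω, onePlusProd X G k ω * blockProd X G k 1 ω ∂P := by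
  have h0 : Integrable (fun ω => onePlusProd X G k ω) P := by
    simpa [blockProd] using integrable_onePlusProd_mul_blockProd (P := P) (l := 0) (m := 0) hX hM
      (show k ≤ n by omega) (by omega)
  rw [← integral_add h0 (integrable_onePlusProd_mul_blockProd hX hM (by omega) (by omega))]
  refine integral_congr_ae (Filter.Eventually.of_forall fun ω => ?_)
  simp only [onePlusProd_succ, blockProd, Finset.prod_range_one, add_zero]
  ring

/-- The last factor but one is bounded by M; it then serves as the gap that makes the last factor
independent of the remaining block. -/
theorem integral_norm_blockProd_add_two (hX : ∀ i ∈ Finset.Icc 1 n, Measurable (X i))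
    (hdep : IsMDependent 1 n X P) {M a : ℝ} (hM : ∀ j, ‖G j‖ ≤ M)
    (ha : ∀ i ∈ Finset.Icc 1 n, ∫ ω, ‖G (X i ω)‖ ∂P ≤ a) {k m : ℕ} (hm : 1 ≤ m)
    (hk : k + (m + 2) ≤ n) :
    ∫ ω, ‖blockProd X G k (m + 2) ω‖ ∂P ≤ a * M * ∫ ω, ‖blockProd X G k m ω‖ ∂P := by
  have hM0 : 0 ≤ M := (norm_nonneg _).trans (hM 0)
  have hG : Measurable (fun ω => ‖G (X (k + 1 + (m + 1)) ω)‖) :=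
    (measurable_from_top (f := fun j => ‖G j‖)).comp
      (hX _ (Finset.mem_Icc.2 ⟨by omega, by omega⟩))
  have hB : Measurable (fun ω => ‖blockProd X G k m ω‖) :=
    (measurable_blockProd' hX (by omega)).norm
  have hprod := integral_mul_of_indep (P := P) (m1 := blockSigma X 1 (k + m))
    (m2 := blockSigma X (k + m + 2) n)
    (blockSigma_le fun i hi => hX i (Finset.Icc_subset_Icc_right (by omega) hi))
    (blockSigma_le fun i hi => hX i (Finset.Icc_subset_Icc_left (by omega) hi))
    (hdep (k + m) (k + m + 2) (by omega) (by omega) (by omega))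
    (measurable_norm.comp
      (measurable_blockProd (X := X) (G := G) (k := k) (m := m) (by omega) le_rfl))
    (measurable_blockSigma_comp X (fun j => ‖G j‖) (i := k + 1 + (m + 1)) (by omega) (by omega))
  calc ∫ ω, ‖blockProd X G k (m + 2) ω‖ ∂P
      ≤ ∫ ω, M * (‖blockProd X G k m ω‖ * ‖G (X (k + 1 + (m + 1)) ω)‖) ∂P := by
        refine integral_mono_of_nonneg (Filter.Eventually.of_forall fun ω => norm_nonneg _) ?_
          (Filter.Eventually.of_forall fun ω => ?_)
        · refine Integrable.of_bound (C := M * (M ^ m * M))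
            ((hB.mul hG).const_mul M).aestronglyMeasurable
            (Filter.Eventually.of_forall fun ω => ?_)
          rw [Real.norm_of_nonneg (by positivity)]
          gcongr
          · exact norm_blockProd_le hM _ _ _
          · exact hM _
        · simp only [blockProd_succ_right, norm_mul]
          have h1 := hM (X (k + 1 + m) ω)
          have h2 : 0 ≤ ‖blockProd X G k m ω‖ * ‖G (X (k + 1 + (m + 1)) ω)‖ := by positivity
          nlinarith [mul_le_mul_of_nonneg_right h1 h2]
    _ = M * ((∫ ω, ‖blockProd X G k m ω‖ ∂P) * ∫ ω, ‖G (X (k + 1 + (m + 1)) ω)‖ ∂P) := by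
        rw [integral_const_mul]
        exact congrArg _ hprod
    _ ≤ M * ((∫ ω, ‖blockProd X G k m ω‖ ∂P) * a) := by
        gcongr
        exact ha _ (Finset.mem_Icc.2 ⟨by omega, by omega⟩)
    _ = _ := by ring

/-- Bounds for the mixed moments of blocks, decaying geometrically in the block length. -/
theorem integral_norm_blockProd_le (hX : ∀ i ∈ Finset.Icc 1 n, Measurable (X i))
    (hdep : IsMDependent 1 n X P) {M a q : ℝ} (hM : ∀ j, ‖G j‖ ≤ M)
    (ha : ∀ i ∈ Finset.Icc 1 n, ∫ ω, ‖G (X i ω)‖ ∂P ≤ a) (ha0 : 0 ≤ a)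
    (hq : ∀ i, 1 ≤ i → i + 1 ≤ n → ∫ ω, ‖G (X i ω) * G (X (i + 1) ω)‖ ∂P ≤ q)
    (k i : ℕ) :
    (k + (2 * i + 1) ≤ n → ∫ ω, ‖blockProd X G k (2 * i + 1) ω‖ ∂P ≤ (a * M) ^ i * a) ∧
    (k + (2 * i + 2) ≤ n → ∫ ω, ‖blockProd X G k (2 * i + 2) ω‖ ∂P ≤ (a * M) ^ i * q) := by
  have hM0 : 0 ≤ M := (norm_nonneg _).trans (hM 0)
  induction i with
  | zero =>
    refine ⟨fun h => ?_, fun h => ?_⟩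
    · simpa [blockProd] using ha (k + 1) (Finset.mem_Icc.2 ⟨by omega, by omega⟩)
    -- Even lengths start from the pair moment q, not from the empty block, so the small factor q
    -- survives.
    · have := hq (k + 1) (by omega) (by omega)
      simpa [blockProd, Finset.prod_range_succ] using this
  | succ i ih =>
    refine ⟨fun h => ?_, fun h => ?_⟩
    · refine (integral_norm_blockProd_add_two hX hdep hM ha (m := 2 * i + 1) (by omega)
        (by omega)).trans ?_
      rw [pow_succ, mul_comm ((a * M) ^ i), mul_assoc (a * M)]
      exact mul_le_mul_of_nonneg_left (ih.1 (by omega)) (by positivity)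
    · refine (integral_norm_blockProd_add_two hX hdep hM ha (m := 2 * i + 2) (by omega)
        (by omega)).trans ?_
      rw [pow_succ, mul_comm ((a * M) ^ i), mul_assoc (a * M)]
      exact mul_le_mul_of_nonneg_left (ih.2 (by omega)) (by positivity)

end

/-! ### The multiplicative recursion for f_k = E ∏_{i≤k}(1 + G(X_i)). -/

section

variable {Ω : Type*} {X : ℕ → Ω → ℕ} {G : ℕ → ℂ} [m0 : MeasurableSpace Ω] {P : Measure Ω}
  [IsProbabilityMeasure P] {n : ℕ}

/-- Induction on k for all block lengths at once, since the recursion passes from length m at k + 1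
to length m + 1 at k. Measuring against |f_k| itself is what later gives relative errors. -/
theorem norm_integral_onePlusProd_mul_blockProd_le
    (hX : ∀ i ∈ Finset.Icc 1 n, Measurable (X i))
    (hdep : IsMDependent 1 n X P) {M a q : ℝ} (hM : ∀ j, ‖G j‖ ≤ M)
    (ha : ∀ i ∈ Finset.Icc 1 n, ∫ ω, ‖G (X i ω)‖ ∂P ≤ a) (ha0 : 0 ≤ a) (hq0 : 0 ≤ q)
    (hq : ∀ i, 1 ≤ i → i + 1 ≤ n → ∫ ω, ‖G (X i ω) * G (X (i + 1) ω)‖ ∂P ≤ q)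
    (hr : a * M ≤ 1 / 10) (hc : 2 * a + 4 * q ≤ 1 / 10) (k : ℕ) :
    ∀ i : ℕ, (k + (2 * i + 1) ≤ n →
      ‖∫ ω, onePlusProd X G k ω * blockProd X G k (2 * i + 1) ω ∂P‖ ≤
        (a * M) ^ i * (2 * a + 4 * q) * ‖∫ ω, onePlusProd X G k ω ∂P‖) ∧
    (k + (2 * i + 2) ≤ n →
      ‖∫ ω, onePlusProd X G k ω * blockProd X G k (2 * i + 2) ω ∂P‖ ≤
        (a * M) ^ i * (2 * q + 4 * (a * M) * a) * ‖∫ ω, onePlusProd X G k ω ∂P‖) := by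
  have hM0 : 0 ≤ M := (norm_nonneg _).trans (hM 0)
  have he := integral_norm_blockProd_le hX hdep hM ha ha0 hq
  have hrho : 0 ≤ a * M := by positivity
  induction k with
  | zero =>
    intro i
    have hp : 0 ≤ (a * M) ^ i := by positivity
    simp only [onePlusProd_zero, one_mul, integral_const, probReal_univ, one_smul, norm_one,
      mul_one]
    refine ⟨fun h => ?_, fun h => ?_⟩
    · refine (norm_integral_le_integral_norm _).trans (((he 0 i).1 h).trans ?_)
      exact mul_le_mul_of_nonneg_left (by linarith) hp
    · refine (norm_integral_le_integral_norm _).trans (((he 0 i).2 h).trans ?_)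
      have : 0 ≤ 4 * (a * M) * a := by positivity
      exact mul_le_mul_of_nonneg_left (by linarith) hp
  | succ k ih =>
    intro i
    have hp : 0 ≤ (a * M) ^ i := by positivity
    -- The case of block length 1 bounds |f_{k+1} - f_k| by |f_k|/10, so a bound in terms of |f_k|
    -- converts to one in terms of |f_{k+1}|.
    have hlow : k + 1 ≤ n → 9 / 10 * ‖∫ ω, onePlusProd X G k ω ∂P‖ ≤
        ‖∫ ω, onePlusProd X G (k + 1) ω ∂P‖ := by
      intro h
      rw [integral_onePlusProd_succ hX hM h]
      have h1 := (ih 0).1 h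
      simp only [pow_zero, one_mul, mul_zero, zero_add] at h1
      have h2 := norm_sub_le_norm_add (∫ ω, onePlusProd X G k ω ∂P)
        (∫ ω, onePlusProd X G k ω * blockProd X G k 1 ω ∂P)
      have h3 := mul_le_mul_of_nonneg_right hc (norm_nonneg (∫ ω, onePlusProd X G k ω ∂P))
      linarith
    refine ⟨fun h => ?_, fun h => ?_⟩
    · rw [integral_onePlusProd_mul_blockProd_succ hX hdep hM (by omega) h]
      refine (norm_add_le _ _).trans ?_
      rw [norm_mul]
      have h1 := (norm_integral_le_integral_norm _).trans ((he (k + 1) i).1 h)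
      have h2 := (ih i).2 (by omega)
      have h3 := hlow (by omega)
      have h4 : 0 ≤ (a * M) ^ i * (2 * a + 4 * q) := by positivity
      have h5 := mul_le_mul_of_nonneg_left h3 h4
      have h6 := mul_le_mul_of_nonneg_left h1 (norm_nonneg (∫ ω, onePlusProd X G k ω ∂P))
      -- The coefficients 2 and 4 are chosen so that the induction closes despite the loss of 9/10;
      -- aM ≤ 1/10 suffices.
      have h7 : a + (2 * q + 4 * (a * M) * a) ≤ 9 / 10 * (2 * a + 4 * q) := by nlinarith
      have h8 := mul_le_mul_of_nonneg_left h7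
        (mul_nonneg hp (norm_nonneg (∫ ω, onePlusProd X G k ω ∂P)))
      linarith
    · rw [integral_onePlusProd_mul_blockProd_succ hX hdep hM (by omega) h]
      refine (norm_add_le _ _).trans ?_
      rw [norm_mul]
      have h1 := (norm_integral_le_integral_norm _).trans ((he (k + 1) i).2 h)
      have h2 := (ih (i + 1)).1 (by omega)
      have h3 := hlow (by omega)
      have h4 : 0 ≤ (a * M) ^ i * (2 * q + 4 * (a * M) * a) := by positivity
      have h5 := mul_le_mul_of_nonneg_left h3 h4
      have h6 := mul_le_mul_of_nonneg_left h1 (norm_nonneg (∫ ω, onePlusProd X G k ω ∂P))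
      have h7 : q + (a * M) * (2 * a + 4 * q) ≤ 9 / 10 * (2 * q + 4 * (a * M) * a) := by
        nlinarith [mul_nonneg hrho ha0]
      have h8 := mul_le_mul_of_nonneg_left h7
        (mul_nonneg hp (norm_nonneg (∫ ω, onePlusProd X G k ω ∂P)))
      rw [pow_succ] at h2
      rw [show 2 * (i + 1) + 1 = 2 * i + 2 + 1 by ring] at h2
      linarith

/-- One-step multiplicative approximation of `E ∏ (1 + G (X i))` for `1`-dependent variables. -/
theorem norm_integral_onePlusProd_succ_sub_le
    (hX : ∀ i ∈ Finset.Icc 1 n, Measurable (X i))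
    (hdep : IsMDependent 1 n X P) {M a q : ℝ} {e : ℂ} (hM : ∀ j, ‖G j‖ ≤ M) (hM2 : 2 ≤ M)
    (ha : ∀ i ∈ Finset.Icc 1 n, ∫ ω, ‖G (X i ω)‖ ∂P ≤ a) (ha0 : 0 ≤ a) (hq0 : 0 ≤ q)
    (hq : ∀ i, 1 ≤ i → i + 1 ≤ n → ∫ ω, ‖G (X i ω) * G (X (i + 1) ω)‖ ∂P ≤ q)
    (he : ∀ i ∈ Finset.Icc 1 n, ∫ ω, G (X i ω) ∂P = e)
    (hr : a * M ≤ 1 / 10) (hc : 2 * a + 4 * q ≤ 1 / 10) {k : ℕ} (hk : k + 1 ≤ n) :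
    ‖(∫ ω, onePlusProd X G (k + 1) ω ∂P) - (1 + e) * ∫ ω, onePlusProd X G k ω ∂P‖ ≤
      (3 * q + 6 * a ^ 2 * M) * ‖∫ ω, onePlusProd X G k ω ∂P‖ := by
  have hM0 : 0 ≤ M := by linarith
  have hT := norm_integral_onePlusProd_mul_blockProd_le hX hdep hM ha ha0 hq0 hq hr hc
  have hb : ∀ k, k + 1 ≤ n → ∫ ω, blockProd X G k 1 ω ∂P = e := fun k hk => by
    simpa [blockProd] using he (k + 1) (Finset.mem_Icc.2 ⟨by omega, hk⟩)
  rcases k with _ | j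
  · rw [integral_onePlusProd_succ hX hM hk]
    simp only [onePlusProd_zero, one_mul, integral_const, probReal_univ, one_smul, mul_one,
      norm_one, hb 0 hk, sub_self, norm_zero]
    positivity
  · have h1 := integral_onePlusProd_succ (P := P) hX hM hk
    have h2 := integral_onePlusProd_succ (P := P) hX hM (k := j) (by omega)
    have h3 := integral_onePlusProd_mul_blockProd_succ hX hdep hM le_rfl hk
    rw [hb (j + 1) hk] at h3
    have t1 := (hT j 0).1 (by omega)
    have t2 := (hT j 0).2 (by omega)
    simp only [pow_zero, one_mul, mul_zero, zero_add] at t1 t2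
    set f0 := ∫ ω, onePlusProd X G j ω ∂P
    set f1 := ∫ ω, onePlusProd X G (j + 1) ω ∂P
    set T1 := ∫ ω, onePlusProd X G j ω * blockProd X G j 1 ω ∂P
    set T2 := ∫ ω, onePlusProd X G j ω * blockProd X G j 2 ω ∂P
    -- The first-order terms cancel, leaving a pair term T2 and a product of two small quantities.
    have heq : (∫ ω, onePlusProd X G (j + 1 + 1) ω ∂P) - (1 + e) * f1 = T2 - e * T1 := by
      rw [h1, h3, h2]
      ring
    have hea : ‖e‖ ≤ a := by
      rw [← he 1 (Finset.mem_Icc.2 ⟨le_rfl, by omega⟩)]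
      exact (norm_integral_le_integral_norm _).trans
        (ha 1 (Finset.mem_Icc.2 ⟨le_rfl, by omega⟩))
    have hlow : 9 / 10 * ‖f0‖ ≤ ‖f1‖ := by
      rw [h2]
      have := norm_sub_le_norm_add f0 T1
      have h3 := mul_le_mul_of_nonneg_right hc (norm_nonneg f0)
      linarith
    rw [heq]
    have hf0 := norm_nonneg f0
    have s1 : ‖e * T1‖ ≤ a * ((2 * a + 4 * q) * ‖f0‖) := by
      rw [norm_mul]
      exact mul_le_mul hea t1 (norm_nonneg _) ha0
    have s2 := norm_sub_le T2 (e * T1)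
    have s3 : (2 * q + 4 * (a * M) * a) + a * (2 * a + 4 * q) ≤
        9 / 10 * (3 * q + 6 * a ^ 2 * M) := by
      nlinarith [mul_nonneg ha0 ha0, mul_le_mul_of_nonneg_left hM2 (mul_nonneg ha0 ha0)]
    have s4 := mul_le_mul_of_nonneg_right s3 hf0
    have s5 : 0 ≤ 3 * q + 6 * a ^ 2 * M := by positivity
    have s6 := mul_le_mul_of_nonneg_left hlow s5
    linarith

end

/-! ### Iterating the recursion, and Taylor bounds for z^k. -/

/-- Telescoping, with |f_k| ≤ (|w| + η)^k. The extra factor |w| on the left replaces the exponent n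
- 1 by n. -/
theorem norm_sub_pow_le_of_step {f : ℕ → ℂ} {w : ℂ} {η : ℝ} {n : ℕ} (h0 : f 0 = 1)
    (hη : 0 ≤ η) (h : ∀ k, k + 1 ≤ n → ‖f (k + 1) - w * f k‖ ≤ η * ‖f k‖) :
    ‖f n - w ^ n‖ * ‖w‖ ≤ n * η * (‖w‖ + η) ^ n := by
  have hw := norm_nonneg w
  have h1 : ∀ k, k ≤ n → ‖f k‖ ≤ (‖w‖ + η) ^ k := by
    intro k
    induction k with
    | zero => simp [h0]
    | succ k ih =>
      intro hk
      have h2 : ‖f (k + 1)‖ ≤ ‖f (k + 1) - w * f k‖ + ‖w * f k‖ := by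
        simpa using norm_add_le (f (k + 1) - w * f k) (w * f k)
      rw [norm_mul] at h2
      have h3 := h k hk
      have h4 := mul_le_mul_of_nonneg_left (ih (by omega)) (add_nonneg hw hη)
      rw [pow_succ']
      linarith
  have h2 : ∀ k, k ≤ n → ‖f k - w ^ k‖ * ‖w‖ ≤ k * η * (‖w‖ + η) ^ k := by
    intro k
    induction k with
    | zero => simp [h0]
    | succ k ih =>
      intro hk
      have h3 : ‖f (k + 1) - w ^ (k + 1)‖ ≤ η * ‖f k‖ + ‖w‖ * ‖f k - w ^ k‖ := by
        rw [show f (k + 1) - w ^ (k + 1) = (f (k + 1) - w * f k) + w * (f k - w ^ k) by ring,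
          ← norm_mul]
        exact (norm_add_le _ _).trans (by linarith [h k hk])
      have h4 := ih (by omega)
      have h5 := h1 k (by omega)
      have hB : 0 ≤ (‖w‖ + η) ^ k := by positivity
      calc ‖f (k + 1) - w ^ (k + 1)‖ * ‖w‖
          ≤ (η * ‖f k‖ + ‖w‖ * ‖f k - w ^ k‖) * ‖w‖ := by gcongr
        _ = ‖w‖ * (η * ‖f k‖ + ‖f k - w ^ k‖ * ‖w‖) := by ring
        _ ≤ (‖w‖ + η) * (η * (‖w‖ + η) ^ k + k * η * (‖w‖ + η) ^ k) := by gcongr; linarith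
        _ = _ := by push_cast; ring
  exact h2 n le_rfl

theorem norm_pow_sub_one_le {z : ℂ} {r : ℝ} (hz : ‖z‖ ≤ r) (hr : 1 ≤ r) (k : ℕ) :
    ‖z ^ k - 1‖ ≤ k * r ^ k * ‖z - 1‖ := by
  have hd := norm_nonneg (z - 1)
  induction k with
  | zero => simp
  | succ k ih =>
    have h1 : ‖z ^ k‖ ≤ r ^ k := by rw [norm_pow]; gcongr
    have h2 : r ^ k ≤ r ^ (k + 1) := pow_le_pow_right₀ hr (by omega)
    calc ‖z ^ (k + 1) - 1‖ = ‖z ^ k * (z - 1) + (z ^ k - 1)‖ := by congr 1; ring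
      _ ≤ ‖z ^ k‖ * ‖z - 1‖ + ‖z ^ k - 1‖ := (norm_add_le _ _).trans (by rw [norm_mul])
      _ ≤ r ^ k * ‖z - 1‖ + k * r ^ k * ‖z - 1‖ := by gcongr
      _ = (k + 1) * r ^ k * ‖z - 1‖ := by ring
      _ ≤ (k + 1) * r ^ (k + 1) * ‖z - 1‖ := by gcongr
      _ = _ := by push_cast; ring

theorem norm_pow_sub_one_sub_le {z : ℂ} {r : ℝ} (hz : ‖z‖ ≤ r) (hr : 1 ≤ r) (k : ℕ) :
    ‖z ^ k - 1 - k * (z - 1)‖ ≤ k * (k - 1) * r ^ k * ‖z - 1‖ ^ 2 := by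
  have hd := norm_nonneg (z - 1)
  induction k with
  | zero => simp
  | succ k ih =>
    have h2 : r ^ k ≤ r ^ (k + 1) := pow_le_pow_right₀ hr (by omega)
    have h3 := norm_pow_sub_one_le hz hr k
    calc ‖z ^ (k + 1) - 1 - (k + 1 : ℕ) * (z - 1)‖
        = ‖(z ^ k - 1 - k * (z - 1)) + (z ^ k - 1) * (z - 1)‖ := by
          congr 1; push_cast; ring
      _ ≤ ‖z ^ k - 1 - k * (z - 1)‖ + ‖z ^ k - 1‖ * ‖z - 1‖ :=
          (norm_add_le _ _).trans (by rw [norm_mul])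
      _ ≤ k * (k - 1) * r ^ k * ‖z - 1‖ ^ 2 + k * r ^ k * ‖z - 1‖ * ‖z - 1‖ := by gcongr
      _ = k * k * r ^ k * ‖z - 1‖ ^ 2 := by ring
      _ ≤ (k + 1) * k * r ^ (k + 1) * ‖z - 1‖ ^ 2 := by gcongr; linarith
      _ = _ := by push_cast; ring

/-- The function `k ↦ z ^ k - 1`, set to zero for `k > C`. -/
noncomputable def truncPowSubOne (C : ℝ) (z : ℂ) (k : ℕ) : ℂ :=
  open Classical in if (k : ℝ) ≤ C then z ^ k - 1 else 0

theorem norm_truncPowSubOne_le {C L r : ℝ} {z : ℂ} (hz : ‖z‖ ≤ r) (hr : 1 ≤ r)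
    (hL : ∀ k : ℕ, (k : ℝ) ≤ C → r ^ k ≤ L) (hL1 : 1 ≤ L) (k : ℕ) :
    ‖truncPowSubOne C z k‖ ≤ 2 * L ∧ ‖truncPowSubOne C z k‖ ≤ ‖z - 1‖ * L * k := by
  unfold truncPowSubOne
  have hd := norm_nonneg (z - 1)
  split_ifs with h
  · have h1 := hL k h
    constructor
    · have h2 : ‖z ^ k‖ ≤ r ^ k := by rw [norm_pow]; gcongr
      have h3 := norm_sub_le (z ^ k) 1
      rw [norm_one] at h3
      linarith
    · refine (norm_pow_sub_one_le hz hr k).trans ?_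
      have : (k : ℝ) * r ^ k * ‖z - 1‖ ≤ k * L * ‖z - 1‖ := by gcongr
      linarith
  · rw [norm_zero]
    constructor <;> positivity

theorem natCast_mul_sub_one_nonneg (k : ℕ) : (0 : ℝ) ≤ (k : ℝ) * ((k : ℝ) - 1) := by
  rcases Nat.eq_zero_or_pos k with h | h
  · simp [h]
  · have : (1 : ℝ) ≤ k := by exact_mod_cast h
    exact mul_nonneg (by positivity) (by linarith)

theorem norm_one_add_exp_step {ν : ℝ} {z e : ℂ} {R : ℝ} (hν : 0 ≤ ν) (hz : ν * ‖z - 1‖ ≤ 1)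
    (he : ‖e - ν * (z - 1)‖ ≤ R) :
    ‖(1 + e) - Complex.exp (ν * (z - 1))‖ ≤ R + ν ^ 2 * ‖z - 1‖ ^ 2 := by
  have hn : ‖(ν : ℂ) * (z - 1)‖ = ν * ‖z - 1‖ := by
    rw [norm_mul, Complex.norm_real, Real.norm_of_nonneg hν]
  have h := Complex.norm_exp_sub_one_sub_id_le (hn.trans_le hz)
  rw [hn, mul_pow] at h
  have h2 : (1 + e) - Complex.exp (ν * (z - 1)) =
      (e - ν * (z - 1)) - (Complex.exp (ν * (z - 1)) - 1 - ν * (z - 1)) := by ring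
  rw [h2]
  exact (norm_sub_le _ _).trans (add_le_add he h)

theorem norm_sub_exp_le_of_step {f : ℕ → ℂ} {z : ℂ} {ν ε : ℝ} {n : ℕ} (hν : 0 ≤ ν)
    (hν1 : ν ≤ 2 / 1000) (hd : ‖z - 1‖ ≤ 21 / 10) (hε : 0 ≤ ε) (h0 : f 0 = 1)
    (h : ∀ k, k + 1 ≤ n → ‖f (k + 1) - Complex.exp (ν * (z - 1)) * f k‖ ≤
      (ε * ‖z - 1‖ ^ 2) * ‖f k‖) :
    ‖f n - Complex.exp (n * ν * (z - 1))‖ ≤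
      11 / 10 * (n * (ε * ‖z - 1‖ ^ 2)) *
        Real.exp (n * (ν * (z - 1).re + 11 / 10 * (ε * ‖z - 1‖ ^ 2))) := by
  set η := ε * ‖z - 1‖ ^ 2
  have hη : 0 ≤ η := by positivity
  set w := Complex.exp (ν * (z - 1)) with hw
  have hfin := norm_sub_pow_le_of_step h0 hη h
  have hwn : Complex.exp (n * ν * (z - 1)) = w ^ n := by
    rw [hw, ← Complex.exp_nat_mul]; congr 1; ring
  have hwnorm : ‖w‖ = Real.exp (ν * (z - 1).re) := by
    rw [hw, Complex.norm_exp, Complex.re_ofReal_mul]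
  have hwlow : 10 / 11 ≤ ‖w‖ := by
    rw [hwnorm]
    have h1 := Real.add_one_le_exp (ν * (z - 1).re)
    have h2 := (abs_le.1 ((Complex.abs_re_le_norm (z - 1)))).1
    nlinarith
  have hB : (‖w‖ + η) ^ n ≤ Real.exp (n * (ν * (z - 1).re + 11 / 10 * η)) := by
    rw [Real.exp_nat_mul]
    refine pow_le_pow_left₀ (by positivity) ?_ n
    rw [Real.exp_add, ← hwnorm]
    have h1 := Real.add_one_le_exp (11 / 10 * η)
    have h2 := mul_le_mul_of_nonneg_left h1 (norm_nonneg w)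
    nlinarith
  rw [hwn]
  have hnn : (0 : ℝ) ≤ n := Nat.cast_nonneg n
  have k1 := mul_le_mul_of_nonneg_left hwlow (norm_nonneg (f n - w ^ n))
  have k2 := mul_le_mul_of_nonneg_left hB (mul_nonneg hnn hη)
  linarith

/-! ### The generating function of the sum. -/

section

variable {Ω : Type*} {X : ℕ → Ω → ℕ} [m0 : MeasurableSpace Ω] {P : Measure Ω}
  [IsProbabilityMeasure P] {n : ℕ}

theorem integrable_natCast_mul_of_ae_le {U V : Ω → ℕ} {C : ℝ} (hU : Measurable U)
    (hV : Measurable V) (hUC : ∀ᵐ ω ∂P, (U ω : ℝ) ≤ C) (hVC : ∀ᵐ ω ∂P, (V ω : ℝ) ≤ C) :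
    Integrable (fun ω => (U ω : ℝ) * (V ω : ℝ)) P := by
  refine Integrable.of_bound (C := C * C) (by fun_prop) ?_
  filter_upwards [hUC, hVC] with ω h1 h2
  rw [Real.norm_of_nonneg (by positivity)]
  gcongr
  exact (Nat.cast_nonneg _).trans h1

theorem integrable_natCast_of_ae_le {U : Ω → ℕ} {C : ℝ} (hU : Measurable U)
    (hUC : ∀ᵐ ω ∂P, (U ω : ℝ) ≤ C) : Integrable (fun ω => (U ω : ℝ)) P := by
  refine Integrable.of_bound (C := C) (by fun_prop) ?_
  filter_upwards [hUC] with ω h1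
  rwa [Real.norm_of_nonneg (by positivity)]

/-- The probability generating function of a sum of `1`-dependent bounded variables is close to
that of a Poisson variable. -/
theorem norm_integral_pow_sum_sub_exp_le (hX : ∀ i ∈ Finset.Icc 1 n, Measurable (X i))
    (hn : 1 ≤ n) (hid : ∀ i ∈ Finset.Icc 1 n, IdentDistrib (X i) (X 1) P P)
    (hdep : IsMDependent 1 n X P) {C L ν₁ ν₂ ν₁₂ : ℝ}
    (hν₁ : ν₁ = ∫ ω, (X 1 ω : ℝ) ∂P)
    (hν₂ : ν₂ = ∫ ω, (X 1 ω : ℝ) * ((X 1 ω : ℝ) - 1) ∂P)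
    (hν₁₂0 : 0 ≤ ν₁₂)
    (hν₁₂ : ∀ i : ℕ, 1 ≤ i → i + 1 ≤ n →
          ∫ ω, (X i ω : ℝ) * (X (i + 1) ω : ℝ) ∂P ≤ ν₁₂)
    (hC : ∀ᵐ ω ∂P, (X 1 ω : ℝ) ≤ C)
    (hL : ∀ k : ℕ, (k : ℝ) ≤ C → (11 / 10 : ℝ) ^ k ≤ L) (hL1 : 1 ≤ L)
    (hLν₁ : L ^ 3 * ν₁ ≤ 2 / 1000) (hLν₁₂ : L ^ 2 * ν₁₂ ≤ ν₁ / 40)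
    {z : ℂ} (hz : ‖z‖ ≤ 11 / 10) {ε : ℝ}
    (hε : ε = L * ν₂ + 3 * (L ^ 2 * ν₁₂) + 13 * (L ^ 3 * ν₁ ^ 2)) :
    ‖(∫ ω, z ^ (∑ i ∈ Finset.Icc 1 n, X i ω) ∂P) - Complex.exp (n * ν₁ * (z - 1))‖ ≤
      11 / 10 * (n * (ε * ‖z - 1‖ ^ 2)) *
        Real.exp (n * (ν₁ * (z - 1).re + 11 / 10 * (ε * ‖z - 1‖ ^ 2))) := by
  have h1mem : 1 ∈ Finset.Icc 1 n := Finset.mem_Icc.2 ⟨le_rfl, hn⟩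
  set d := ‖z - 1‖ with hd_def
  have hd0 : 0 ≤ d := norm_nonneg _
  have hd : d ≤ 21 / 10 := by
    have := norm_sub_le z 1
    rw [norm_one] at this
    linarith
  have hL0 : 0 ≤ L := by linarith
  have hν₁0 : 0 ≤ ν₁ := by rw [hν₁]; positivity
  have hν₂0 : 0 ≤ ν₂ := hν₂ ▸ integral_nonneg fun ω => natCast_mul_sub_one_nonneg _
  have hL2 : 1 ≤ L ^ 2 := one_le_pow₀ hL1
  have hL3 : 1 ≤ L ^ 3 := one_le_pow₀ hL1
  have hL23 : L ^ 2 ≤ L ^ 3 := pow_le_pow_right₀ hL1 (by norm_num)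
  have hL13 : L ≤ L ^ 3 := le_self_pow₀ hL1 (by norm_num)
  have hν₁s : ν₁ ≤ 2 / 1000 := by nlinarith
  have hCi : ∀ i ∈ Finset.Icc 1 n, ∀ᵐ ω ∂P, (X i ω : ℝ) ≤ C := fun i hi =>
    (hid i hi).symm.ae_snd (p := fun k : ℕ => (k : ℝ) ≤ C) (MeasurableSet.of_discrete) hC
  have hmean : ∀ i ∈ Finset.Icc 1 n, ∫ ω, (X i ω : ℝ) ∂P = ν₁ := fun i hi => by
    rw [hν₁]
    exact ((hid i hi).comp (u := fun k : ℕ => (k : ℝ)) Measurable.of_discrete).integral_eq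
  -- The truncation makes G bounded everywhere, as the block estimates require, and changes nothing
  -- almost surely.
  set G := truncPowSubOne C z
  have hGb := norm_truncPowSubOne_le hz (by norm_num) hL hL1
  have hGm : Measurable G := Measurable.of_discrete
  set e := ∫ ω, G (X 1 ω) ∂P with he_def
  have he : ∀ i ∈ Finset.Icc 1 n, ∫ ω, G (X i ω) ∂P = e := fun i hi =>
    ((hid i hi).comp (u := G) Measurable.of_discrete).integral_eq
  have hea : ‖e - ν₁ * (z - 1)‖ ≤ L * ν₂ * d ^ 2 := by
    have hi1 : Integrable (fun ω => G (X 1 ω)) P :=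
      Integrable.of_bound (C := 2 * L) (hGm.comp (hX 1 h1mem)).aestronglyMeasurable
        (Filter.Eventually.of_forall fun ω => (hGb _).1)
    have hX1 := integrable_natCast_of_ae_le (P := P) (hX 1 h1mem) hC
    have hXX := integrable_natCast_mul_of_ae_le (P := P) (hX 1 h1mem) (hX 1 h1mem) hC hC
    have hi2 : Integrable (fun ω => ((X 1 ω : ℝ) : ℂ) * (z - 1)) P := hX1.ofReal.mul_const _
    have heq : e - ν₁ * (z - 1) = ∫ ω, (G (X 1 ω) - ((X 1 ω : ℝ) : ℂ) * (z - 1)) ∂P := by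
      rw [integral_sub hi1 hi2, integral_mul_const, hν₁, integral_complex_ofReal]
    rw [heq, show L * ν₂ * d ^ 2 = (L * d ^ 2) * ν₂ by ring, hν₂, ← integral_const_mul]
    refine norm_integral_le_of_norm_le (((hXX.sub hX1).congr
      (Filter.Eventually.of_forall fun ω => ?_)).const_mul _) ?_
    · simp only [Pi.sub_apply]; ring
    · filter_upwards [hC] with ω hω
      have h1 := norm_pow_sub_one_sub_le hz (by norm_num) (X 1 ω)
      have h2 : G (X 1 ω) = z ^ (X 1 ω) - 1 := if_pos hω
      rw [h2, Complex.ofReal_natCast]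
      refine h1.trans ?_
      have h4 := mul_le_mul_of_nonneg_left (hL _ hω)
        (natCast_mul_sub_one_nonneg (X 1 ω))
      have h5 := mul_le_mul_of_nonneg_right h4 (sq_nonneg d)
      linarith
  have ha : ∀ i ∈ Finset.Icc 1 n, ∫ ω, ‖G (X i ω)‖ ∂P ≤ d * L * ν₁ := fun i hi => by
    rw [← hmean i hi, ← integral_const_mul]
    exact integral_mono_of_nonneg (Filter.Eventually.of_forall fun ω => norm_nonneg _)
      ((integrable_natCast_of_ae_le (hX i hi) (hCi i hi)).const_mul _)
      (Filter.Eventually.of_forall fun ω => (hGb _).2)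
  have hq : ∀ i, 1 ≤ i → i + 1 ≤ n →
      ∫ ω, ‖G (X i ω) * G (X (i + 1) ω)‖ ∂P ≤ d ^ 2 * (L ^ 2 * ν₁₂) := fun i hi hin => by
    have m1 : i ∈ Finset.Icc 1 n := Finset.mem_Icc.2 ⟨hi, by omega⟩
    have m2 : i + 1 ∈ Finset.Icc 1 n := Finset.mem_Icc.2 ⟨by omega, hin⟩
    have h1 := mul_le_mul_of_nonneg_left (hν₁₂ i hi hin)
      (show 0 ≤ d ^ 2 * L ^ 2 by positivity)
    rw [← integral_const_mul] at h1
    rw [← mul_assoc]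
    refine le_trans ?_ h1
    refine integral_mono_of_nonneg (Filter.Eventually.of_forall fun ω => norm_nonneg _)
      ((integrable_natCast_mul_of_ae_le (hX i m1) (hX _ m2) (hCi i m1) (hCi _ m2)).const_mul _)
      (Filter.Eventually.of_forall fun ω => ?_)
    simp only [norm_mul]
    refine (mul_le_mul (hGb _).2 (hGb _).2 (norm_nonneg _) (by positivity)).trans (le_of_eq ?_)
    ring
  have hd2 : d ^ 2 ≤ 441 / 100 := by nlinarith
  have hLν : L ^ 2 * ν₁ ≤ 2 / 1000 := by nlinarith
  have hLν' : L * ν₁ ≤ 2 / 1000 := by nlinarith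
  have ha0 : 0 ≤ d * L * ν₁ := by positivity
  have hq0 : 0 ≤ d ^ 2 * (L ^ 2 * ν₁₂) := by positivity
  have ha1 : d * L * ν₁ ≤ 1 / 200 := by nlinarith [mul_nonneg hL0 hν₁0]
  have hq1 : d ^ 2 * (L ^ 2 * ν₁₂) ≤ 1 / 200 := by
    nlinarith [mul_nonneg (pow_nonneg hL0 2) hν₁₂0]
  have haM : d * L * ν₁ * (2 * L) ≤ 1 / 10 := by
    nlinarith [mul_nonneg (pow_nonneg hL0 2) hν₁0]
  set f : ℕ → ℂ := fun k => ∫ ω, onePlusProd X G k ω ∂P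
  set w := Complex.exp (ν₁ * (z - 1)) with hw
  have hε0 : 0 ≤ ε := by rw [hε]; positivity
  have hstep : ∀ k, k + 1 ≤ n → ‖f (k + 1) - w * f k‖ ≤ (ε * d ^ 2) * ‖f k‖ := fun k hk => by
    have s1 := norm_integral_onePlusProd_succ_sub_le hX hdep (fun j => (hGb j).1)
      (by linarith) ha ha0 hq0 hq he haM (by linarith) hk
    have s2 := norm_one_add_exp_step hν₁0 (by nlinarith) hea
    have s3 : f (k + 1) - w * f k = (f (k + 1) - (1 + e) * f k) + ((1 + e) - w) * f k := by ring
    rw [s3]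
    refine (norm_add_le _ _).trans ?_
    rw [norm_mul]
    have s4 := mul_le_mul_of_nonneg_right s2 (norm_nonneg (f k))
    have s5 : ν₁ ^ 2 ≤ L ^ 3 * ν₁ ^ 2 := le_mul_of_one_le_left (sq_nonneg _) hL3
    -- The 13 in ε is 6·2, from a = dLν₁ and M = 2L, plus 1 from the quadratic error of the
    -- exponential.
    have s6 : (3 * (d ^ 2 * (L ^ 2 * ν₁₂)) + 6 * (d * L * ν₁) ^ 2 * (2 * L)) +
        (L * ν₂ * d ^ 2 + ν₁ ^ 2 * d ^ 2) ≤ ε * d ^ 2 := by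
      rw [hε]
      nlinarith [mul_le_mul_of_nonneg_right s5 (sq_nonneg d)]
    have s7 := mul_le_mul_of_nonneg_right s6 (norm_nonneg (f k))
    linarith
  have hfn : ∫ ω, z ^ (∑ i ∈ Finset.Icc 1 n, X i ω) ∂P = f n := by
    refine integral_congr_ae ?_
    have hall : ∀ᵐ ω ∂P, ∀ i ∈ Finset.Icc 1 n, (X i ω : ℝ) ≤ C := by
      rw [Finset.eventually_all]
      exact hCi
    filter_upwards [hall] with ω hω
    rw [← Finset.prod_pow_eq_pow_sum]
    refine Finset.prod_congr rfl fun i hi => ?_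
    have : G (X i ω) = z ^ (X i ω) - 1 := if_pos (hω i hi)
    rw [this]; ring
  rw [hfn]
  exact norm_sub_exp_le_of_step hν₁0 hν₁s hd hε0 (by simp [f, onePlusProd_zero]) hstep

end

/-! ### Integration over the circle. -/

theorem norm_ofReal_mul_exp_sub_one_sq (r t : ℝ) :
    ‖(r : ℂ) * Complex.exp (t * Complex.I) - 1‖ ^ 2 =
      (r - 1) ^ 2 + 2 * r * (1 - Real.cos t) := by
  rw [← Complex.normSq_eq_norm_sq, Complex.normSq_apply]
  simp only [Complex.sub_re, Complex.re_ofReal_mul, Complex.exp_ofReal_mul_I_re, Complex.one_re,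
    Complex.sub_im, Complex.im_ofReal_mul, Complex.exp_ofReal_mul_I_im, Complex.one_im]
  linear_combination r ^ 2 * Real.sin_sq_add_cos_sq t

theorem re_ofReal_mul_exp_sub_one (r t : ℝ) :
    ((r : ℂ) * Complex.exp (t * Complex.I) - 1).re = (r - 1) - r * (1 - Real.cos t) := by
  simp only [Complex.sub_re, Complex.re_ofReal_mul, Complex.exp_ofReal_mul_I_re, Complex.one_re]
  ring

/-- With u = 1 - cos t, the real part of z - 1 supplies decay that outweighs the error exponent
because ε ≤ 0.15ν. -/
theorem mul_exp_le_gaussian {ν ε r y t : ℝ} {n : ℕ} (hn : 1 ≤ n) (hν : 0 < ν) (hε : 0 ≤ ε)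
    (hεν : ε ≤ 15 / 100 * ν) (hr : r = 1 + y) (hy : |y| ≤ 1 / 10) (ht : |t| ≤ Real.pi) :
    11 / 10 * (n * (ε * ‖(r : ℂ) * Complex.exp (t * Complex.I) - 1‖ ^ 2)) *
        Real.exp (n * (ν * ((r : ℂ) * Complex.exp (t * Complex.I) - 1).re +
          11 / 10 * (ε * ‖(r : ℂ) * Complex.exp (t * Complex.I) - 1‖ ^ 2))) ≤
      11 / 10 * (n * ε * y ^ 2 + 8 * (ε / ν)) *
        Real.exp (n * ν * y + 11 / 10 * (n * ε * y ^ 2)) *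
          Real.exp (-(6 / 100 * (n * ν)) * t ^ 2) := by
  rw [norm_ofReal_mul_exp_sub_one_sq, re_ofReal_mul_exp_sub_one]
  obtain ⟨hy1, hy2⟩ := abs_le.1 hy
  set u := 1 - Real.cos t with hu
  have hu0 : 0 ≤ u := by linarith [Real.cos_le_one t]
  have hut : 2 / 10 * t ^ 2 ≤ u := by
    have h1 := Real.cos_le_one_sub_mul_cos_sq ht
    have hp : Real.pi ^ 2 ≤ 10 := by nlinarith [Real.pi_lt_d2, Real.pi_pos]
    have h2 : 2 / 10 ≤ 2 / Real.pi ^ 2 := by gcongr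
    nlinarith [mul_le_mul_of_nonneg_right h2 (sq_nonneg t)]
  have hn0 : (1 : ℝ) ≤ n := by exact_mod_cast hn
  have hl : 0 < n * ν := by positivity
  rw [show r - 1 = y by linarith]
  set l := n * ν with hl_def
  have hy3 : y ^ 2 + 2 * r * u ≤ y ^ 2 + 22 / 10 * u := by nlinarith
  -- The decay 0.6lu comes from 0.9·(1 - 0.33). It is split in two: one half absorbs the polynomial
  -- factor u at cost 8/l, the other becomes the Gaussian through u ≥ 0.2t².
  have hexp : n * (ν * (y - r * u) + 11 / 10 * (ε * (y ^ 2 + 2 * r * u))) ≤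
      (l * y + 11 / 10 * (n * ε * y ^ 2)) + (-(3 / 10 * l * u) + -(3 / 10 * l * u)) := by
    have h1 : ε * (r * u) ≤ 15 / 100 * ν * (r * u) :=
      mul_le_mul_of_nonneg_right hεν (mul_nonneg (by linarith) hu0)
    have h2 : ν * (9 / 10 * u) ≤ ν * (r * u) :=
      mul_le_mul_of_nonneg_left (mul_le_mul_of_nonneg_right (by linarith) hu0) hν.le
    have h3 : ν * (y - r * u) + 11 / 10 * (ε * (y ^ 2 + 2 * r * u)) ≤
        ν * y + 11 / 10 * (ε * y ^ 2) - 6 / 10 * (ν * u) := by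
      have : 0 ≤ ν * u := by positivity
      linarith
    have h4 := mul_le_mul_of_nonneg_left h3 (show (0 : ℝ) ≤ n by linarith)
    rw [hl_def]
    linarith
  have hpoly : (y ^ 2 + 22 / 10 * u) * Real.exp (-(3 / 10 * l * u)) ≤ y ^ 2 + 8 / l := by
    have h1 : Real.exp (-(3 / 10 * l * u)) ≤ 1 := Real.exp_le_one_iff.2 (by
      have : 0 ≤ 3 / 10 * l * u := by positivity
      linarith)
    have h2 : 3 / 10 * l * u * Real.exp (-(3 / 10 * l * u)) ≤ 1 := by
      rw [Real.exp_neg, ← div_eq_mul_inv, div_le_one (Real.exp_pos _)]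
      linarith [Real.add_one_le_exp (3 / 10 * l * u)]
    have h3 : 22 / 10 * u * Real.exp (-(3 / 10 * l * u)) ≤ 8 / l := by
      rw [le_div_iff₀ hl]
      linarith
    nlinarith [mul_le_mul_of_nonneg_left h1 (sq_nonneg y)]
  have hgauss : Real.exp (-(3 / 10 * l * u)) ≤ Real.exp (-(6 / 100 * l) * t ^ 2) := by
    refine Real.exp_le_exp.2 ?_
    nlinarith [mul_le_mul_of_nonneg_left hut hl.le]
  have hne : 0 ≤ n * ε := by positivity
  calc 11 / 10 * (n * (ε * (y ^ 2 + 2 * r * u))) *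
        Real.exp (n * (ν * (y - r * u) + 11 / 10 * (ε * (y ^ 2 + 2 * r * u))))
      ≤ 11 / 10 * (n * (ε * (y ^ 2 + 22 / 10 * u))) *
        Real.exp ((l * y + 11 / 10 * (n * ε * y ^ 2)) +
          (-(3 / 10 * l * u) + -(3 / 10 * l * u))) := by gcongr
    _ = 11 / 10 * (n * ε) * ((y ^ 2 + 22 / 10 * u) * Real.exp (-(3 / 10 * l * u))) *
        Real.exp (l * y + 11 / 10 * (n * ε * y ^ 2)) * Real.exp (-(3 / 10 * l * u)) := by
        rw [Real.exp_add, Real.exp_add (-(3 / 10 * l * u))]; ring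
    _ ≤ 11 / 10 * (n * ε) * (y ^ 2 + 8 / l) *
        Real.exp (l * y + 11 / 10 * (n * ε * y ^ 2)) * Real.exp (-(6 / 100 * l) * t ^ 2) := by
        gcongr
    _ = _ := by
        rw [hl_def]
        field_simp

theorem intervalIntegral_gaussian_le {l : ℝ} (hl : 0 < l) :
    ∫ t in (-Real.pi)..Real.pi, Real.exp (-(6 / 100 * l) * t ^ 2) ≤ 8 / √l := by
  rw [intervalIntegral.integral_of_le (by linarith [Real.pi_pos])]
  refine (setIntegral_le_integral (integrable_exp_neg_mul_sq (by positivity))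
    (Filter.Eventually.of_forall fun t => (Real.exp_pos _).le)).trans ?_
  rw [integral_gaussian]
  have h : Real.pi / (6 / 100 * l) ≤ 8 ^ 2 / l := by
    rw [div_le_div_iff₀ (by positivity) hl]
    nlinarith [Real.pi_lt_d2]
  refine (Real.sqrt_le_sqrt h).trans (le_of_eq ?_)
  rw [Real.sqrt_div (by norm_num), Real.sqrt_sq (by norm_num)]

/-- As x = lr, the left factor r^x turns l^x into x^x, which Stirling cancels against x!. The clean
constant 2 uses 1.1·e ≤ π. -/
theorem poissonMeasure_real_singleton_lower {l r : ℝ} {x : ℕ} (hl : 0 < l) (hx : 1 ≤ x)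
    (hxl : (x : ℝ) = l * r) (hr : r ≤ 11 / 10) :
    2 * Real.exp (l * (r - 1)) / √l ≤
      2 * Real.pi * r ^ x * (poissonMeasure (Real.toNNReal l)).real {x} := by
  rw [poissonMeasure_real_singleton, Real.coe_toNNReal _ hl.le]
  have hx0 : (0 : ℝ) < x := by exact_mod_cast hx
  have hf := factorial_le_stirling hx
  have hfp : (0 : ℝ) < x.factorial := by exact_mod_cast x.factorial_pos
  have hsx : √(x : ℝ) ≤ 11 / 10 * √l := by
    rw [show (11 / 10 : ℝ) * √l = √((11 / 10) ^ 2 * l) by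
      rw [Real.sqrt_mul (by norm_num), Real.sqrt_sq (by norm_num)]]
    exact Real.sqrt_le_sqrt (by nlinarith)
  have hsl : 0 < √l := Real.sqrt_pos.2 hl
  have hee : Real.exp (x : ℝ) = Real.exp 1 ^ x := by rw [← Real.exp_nat_mul, mul_one]
  have hxx : r ^ x * (Real.exp (-l) * l ^ x) = Real.exp (-l) * (x : ℝ) ^ x := by
    rw [hxl, mul_pow]; ring
  have hexp : Real.exp (l * (r - 1)) = Real.exp (-l) * Real.exp 1 ^ x := by
    rw [← hee, ← Real.exp_add, hxl]; congr 1; ring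
  rw [hexp, show 2 * Real.pi * r ^ x * (Real.exp (-l) * l ^ x / x.factorial) =
    2 * Real.pi * (r ^ x * (Real.exp (-l) * l ^ x)) / x.factorial by ring, hxx,
    div_le_div_iff₀ hsl hfp]
  have h1 : (x.factorial : ℝ) ≤ Real.pi * √l * (x / Real.exp 1) ^ x := by
    refine hf.trans (mul_le_mul_of_nonneg_right ?_ (by positivity))
    calc Real.exp 1 * √(x : ℝ) ≤ 2.7182818286 * (11 / 10 * √l) :=
          mul_le_mul Real.exp_one_lt_d9.le hsx (Real.sqrt_nonneg _) (by norm_num)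
      _ ≤ Real.pi * √l := by nlinarith [Real.pi_gt_d2]
  have h2 : Real.exp 1 ^ x * (x / Real.exp 1) ^ x = (x : ℝ) ^ x := by
    rw [← mul_pow, mul_div_cancel₀ _ (Real.exp_pos 1).ne']
  calc 2 * (Real.exp (-l) * Real.exp 1 ^ x) * x.factorial
      ≤ 2 * (Real.exp (-l) * Real.exp 1 ^ x) * (Real.pi * √l * (x / Real.exp 1) ^ x) := by gcongr
    _ = 2 * Real.pi * (Real.exp (-l) * (Real.exp 1 ^ x * (x / Real.exp 1) ^ x)) * √l := by ring
    _ = _ := by rw [h2]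

/-- Transfer from generating functions on a circle to point probabilities. -/
theorem abs_measureReal_div_poisson_sub_one_le {Ω : Type*} [MeasurableSpace Ω] {P : Measure Ω}
    [IsProbabilityMeasure P] {S : Ω → ℕ} (hS : Measurable S) {ν ε r y : ℝ} {n x : ℕ}
    (hn : 1 ≤ n) (hν : 0 < ν) (hε : 0 ≤ ε) (hεν : ε ≤ 15 / 100 * ν) (hr : r = 1 + y)
    (hy : |y| ≤ 1 / 10) (hx : 1 ≤ x) (hxl : (x : ℝ) = n * ν * r)
    (hint : Integrable (fun ω => r ^ S ω) P)
    (h : ∀ z : ℂ, ‖z‖ ≤ 11 / 10 → ‖(∫ ω, z ^ S ω ∂P) - Complex.exp (n * ν * (z - 1))‖ ≤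
      11 / 10 * (n * (ε * ‖z - 1‖ ^ 2)) *
        Real.exp (n * (ν * (z - 1).re + 11 / 10 * (ε * ‖z - 1‖ ^ 2)))) :
    |P.real {ω | S ω = x} / (poissonMeasure (Real.toNNReal (n * ν))).real {x} - 1| ≤
      22 / 5 * (n * ε * y ^ 2 + 8 * (ε / ν)) * Real.exp (11 / 10 * (n * ε * y ^ 2)) := by
  have hn0 : (1 : ℝ) ≤ n := by exact_mod_cast hn
  have hl : 0 < n * ν := by positivity
  obtain ⟨hy1, hy2⟩ := abs_le.1 hy
  have hr0 : 0 < r := by linarith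
  have hr1 : r ≤ 11 / 10 := by linarith
  set l := n * ν with hl_def
  set Q := (poissonMeasure (Real.toNNReal l)).real {x} with hQ
  have hQ0 : 0 < Q := poissonMeasure_real_singleton_pos x (Real.toNNReal_pos.2 hl)
  have hlow : 2 * Real.exp (l * (r - 1)) / √l ≤ 2 * Real.pi * r ^ x * Q :=
    poissonMeasure_real_singleton_lower hl hx hxl hr1
  have e1 := two_pi_mul_measureReal_eq P hS hr0 hint x
  have e2 := two_pi_mul_measureReal_eq (poissonMeasure (Real.toNNReal l)) (S := fun k => k)
    measurable_id hr0 (integrable_pow_poissonMeasure _ r) x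
  simp only [Set.ofPred_eq_eq_singleton, integral_pow_poissonMeasure] at e2
  have hlc : (((Real.toNNReal l : NNReal) : ℝ) : ℂ) = n * ν := by
    rw [Real.coe_toNNReal _ hl.le, hl_def]; push_cast; ring
  rw [hlc] at e2
  set pS := P.real {ω | S ω = x}
  set K := 11 / 10 * (n * ε * y ^ 2 + 8 * (ε / ν)) *
        Real.exp (l * y + 11 / 10 * (n * ε * y ^ 2)) with hK
  have hK0 : 0 ≤ K := by positivity
  have hzn : ∀ t : ℝ, ‖(r : ℂ) * Complex.exp (t * Complex.I)‖ = r := fun t => by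
    rw [norm_mul, Complex.norm_exp_ofReal_mul_I, mul_one, Complex.norm_real,
      Real.norm_of_nonneg hr0.le]
  have hexpn : ∀ t : ℝ, ‖Complex.exp (-(x * (t * Complex.I)))‖ = 1 := fun t => by
    rw [show -((x : ℂ) * (t * Complex.I)) = ((-(x * t) : ℝ) : ℂ) * Complex.I by
        push_cast; ring, Complex.norm_exp_ofReal_mul_I]
  have hcS : Continuous fun t : ℝ => ∫ ω, ((r : ℂ) * Complex.exp (t * Complex.I)) ^ S ω ∂P := by
    refine continuous_of_dominated (bound := fun ω => r ^ S ω) (fun t => ?_) (fun t => ?_) hint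
      (Filter.Eventually.of_forall fun ω => by fun_prop)
    · exact (Measurable.of_discrete (f := fun k : ℕ =>
        ((r : ℂ) * Complex.exp (t * Complex.I)) ^ k)).comp hS |>.aestronglyMeasurable
    · exact Filter.Eventually.of_forall fun ω => by rw [norm_pow, hzn]
  have hdiff : |2 * Real.pi * r ^ x * pS - 2 * Real.pi * r ^ x * Q| ≤ K * (8 / √l) := by
    have e3 : ((2 * Real.pi * r ^ x * pS - 2 * Real.pi * r ^ x * Q : ℝ) : ℂ) =
        ∫ t in (-Real.pi)..Real.pi,
          ((∫ ω, ((r : ℂ) * Complex.exp (t * Complex.I)) ^ S ω ∂P) -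
            Complex.exp (n * ν * ((r : ℂ) * Complex.exp (t * Complex.I) - 1))) *
          Complex.exp (-(x * (t * Complex.I))) := by
      rw [Complex.ofReal_sub, e1, e2, ← intervalIntegral.integral_sub]
      · simp only [sub_mul]
      · exact Continuous.intervalIntegrable (by fun_prop) _ _
      · exact Continuous.intervalIntegrable (by fun_prop) _ _
    rw [← Real.norm_eq_abs, ← Complex.norm_real, e3]
    have hpi : -Real.pi ≤ Real.pi := by linarith [Real.pi_pos]
    refine (intervalIntegral.norm_integral_le_of_norm_le hpi
      (g := fun t => K * Real.exp (-(6 / 100 * l) * t ^ 2))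
      (Filter.Eventually.of_forall fun t ht => ?_)
      (Continuous.intervalIntegrable (by fun_prop) _ _)).trans ?_
    · rw [norm_mul, hexpn, mul_one]
      refine (h _ ((hzn t).trans_le hr1)).trans ?_
      exact mul_exp_le_gaussian hn hν hε hεν hr hy (abs_le.2 ⟨ht.1.le, ht.2⟩)
    · rw [intervalIntegral.integral_const_mul]
      exact mul_le_mul_of_nonneg_left (intervalIntegral_gaussian_le hl) hK0
  set D := 2 * Real.pi * r ^ x with hD
  have hD0 : 0 < D := by positivity
  have hsl : 0 < √l := Real.sqrt_pos.2 hl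
  rw [show pS / Q - 1 = (D * pS - D * Q) / (D * Q) by field_simp, abs_div,
    abs_of_pos (show 0 < D * Q by positivity), div_le_iff₀ (by positivity)]
  refine hdiff.trans ?_
  have hyr : r - 1 = y := by linarith
  rw [hyr] at hlow
  -- The factors exp(ly) and 1/√l cancel; 22/5 is (11/10)·8/2.
  refine le_trans (le_of_eq ?_) (mul_le_mul_of_nonneg_left hlow (by positivity))
  rw [hK, Real.exp_add]
  ring

/-! ### The Cramér series and the final constants. -/

theorem abs_cramerSeries_le {n : ℕ} {ν y : ℝ} (hν : 0 ≤ ν) (hν1 : ν ≤ 1 / 2) (hy : |y| ≤ 1 / 2) :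
    |cramerSeries n ν y| ≤ 2 * n * ν ^ 2 * y ^ 2 := by
  set b := ν / (1 - ν) with hb
  have h1 : 0 < 1 - ν := by linarith
  have hb0 : 0 ≤ b := by positivity
  have hb1 : b ≤ 1 := by rw [hb, div_le_one h1]; linarith
  have hterm : ∀ k : ℕ, ‖b ^ (k + 2) * (y ^ (k + 2) / (((k : ℝ) + 2) * ((k : ℝ) + 1)))‖ ≤
      b ^ 2 * y ^ 2 / 2 * (1 / 2) ^ k := by
    intro k
    have hk : (0 : ℝ) ≤ k := Nat.cast_nonneg k
    have hden : (2 : ℝ) ≤ ((k : ℝ) + 2) * ((k : ℝ) + 1) := by nlinarith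
    rw [norm_mul, norm_div, norm_pow, norm_pow, Real.norm_of_nonneg hb0,
      Real.norm_of_nonneg (show (0 : ℝ) ≤ ((k : ℝ) + 2) * ((k : ℝ) + 1) by positivity),
      Real.norm_eq_abs, pow_add, pow_add, sq_abs]
    have e1 : b ^ k ≤ 1 := pow_le_one₀ hb0 hb1
    have e2 : |y| ^ k ≤ (1 / 2) ^ k := by gcongr
    calc b ^ k * b ^ 2 * (|y| ^ k * y ^ 2 / (((k : ℝ) + 2) * ((k : ℝ) + 1)))
        ≤ 1 * b ^ 2 * ((1 / 2) ^ k * y ^ 2 / 2) := by gcongr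
      _ = _ := by ring
  have hs : HasSum (fun k : ℕ => b ^ 2 * y ^ 2 / 2 * (1 / 2 : ℝ) ^ k)
      (b ^ 2 * y ^ 2 / 2 * 2) := hasSum_geometric_two.mul_left _
  have hsum := tsum_of_norm_bounded hs hterm
  rw [cramerSeries, abs_mul, abs_mul, abs_neg, Nat.abs_cast, abs_of_pos h1]
  rw [Real.norm_eq_abs] at hsum
  have hbν : (1 - ν) * b ^ 2 ≤ 2 * ν ^ 2 := by
    rw [hb, div_pow, mul_div_assoc', div_le_iff₀ (by positivity)]
    nlinarith [mul_nonneg (sq_nonneg ν) h1.le]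
  calc n * (1 - ν) * |∑' k : ℕ, b ^ (k + 2) * (y ^ (k + 2) / (((k : ℝ) + 2) * ((k : ℝ) + 1)))|
      ≤ n * (1 - ν) * (b ^ 2 * y ^ 2 / 2 * 2) := by gcongr
    _ = n * ((1 - ν) * b ^ 2) * y ^ 2 := by ring
    _ ≤ n * (2 * ν ^ 2) * y ^ 2 := by gcongr
    _ = _ := by ring

theorem exists_theta_of_abs_sub_le {R G B : ℝ} (hB : 0 < B) (hG : 0 < G)
    (h : |R - G| ≤ B * G) : ∃ θ : ℝ, |θ| ≤ 1 ∧ R = G * (1 + θ * B) := by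
  refine ⟨(R - G) / (B * G), ?_, by field_simp; ring⟩
  rw [abs_div, abs_of_pos (by positivity : 0 < B * G)]
  exact div_le_one_of_le₀ h (by positivity)

/-- Replacing the leading term `1` by a correction factor of the same order. -/
theorem abs_sub_correction_le {R Λ A s : ℝ} {n : ℕ} (hs : 0 ≤ s) (hs1 : 20 * s ≤ 1)
    (hΛ : |Λ| ≤ n * s) (hA : 0 ≤ A)
    (hR : |R - 1| ≤ 600 * (A + n * s) * Real.exp (19 * (n * s))) :
    |R - Real.exp Λ * (1 + 40 * s) ^ n| ≤
      700 * (A + n * s) * (Real.exp Λ * (1 + 40 * s) ^ n) := by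
  set G := Real.exp Λ * (1 + 40 * s) ^ n with hGd
  obtain ⟨hΛ1, hΛ2⟩ := abs_le.1 hΛ
  have hns : 0 ≤ n * s := by positivity
  -- Here exp(20s) ≤ 1 + 40s, and one of the 20 is spent on Λ ≥ -ns; the upper bound 41 is 40 + 1.
  have hlow : Real.exp (19 * (n * s)) ≤ G := by
    have h1 : Real.exp (20 * s) ≤ 1 + 40 * s := by
      have h2 := Real.norm_exp_sub_one_sub_id_le (x := 20 * s)
        (by rw [Real.norm_of_nonneg (by positivity)]; exact hs1)
      rw [Real.norm_of_nonneg (show 0 ≤ 20 * s by positivity)] at h2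
      have h3 := (le_abs_self _).trans h2
      nlinarith
    calc Real.exp (19 * (n * s)) ≤ Real.exp (Λ + n * (20 * s)) :=
          Real.exp_le_exp.2 (by linarith)
      _ = Real.exp Λ * Real.exp (20 * s) ^ n := by rw [Real.exp_add, Real.exp_nat_mul]
      _ ≤ G := by rw [hGd]; gcongr
  have hup : G ≤ Real.exp (41 * (n * s)) := by
    have h1 : 1 + 40 * s ≤ Real.exp (40 * s) := by linarith [Real.add_one_le_exp (40 * s)]
    calc G ≤ Real.exp Λ * Real.exp (40 * s) ^ n := by rw [hGd]; gcongr
      _ = Real.exp (Λ + n * (40 * s)) := by rw [Real.exp_add, Real.exp_nat_mul]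
      _ ≤ _ := Real.exp_le_exp.2 (by linarith)
  have hG1 : 1 ≤ G := (Real.one_le_exp (by positivity)).trans hlow
  have hGe : G - 1 ≤ 41 * (n * s) * G := by
    have h1 := Real.add_one_le_exp (-(41 * (n * s)))
    have h2 : G * Real.exp (-(41 * (n * s))) ≤ 1 := by
      rw [Real.exp_neg, ← div_eq_mul_inv]
      exact div_le_one_of_le₀ hup (Real.exp_pos _).le
    nlinarith
  have hR2 : |R - 1| ≤ 600 * (A + n * s) * G :=
    hR.trans (mul_le_mul_of_nonneg_left hlow (by positivity))
  have h3 : |R - G| ≤ |R - 1| + |G - 1| := by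
    rw [abs_sub_comm G 1]; exact abs_sub_le R 1 G
  rw [abs_of_nonneg (show 0 ≤ G - 1 by linarith)] at h3
  have h4 : 0 ≤ A * G := by positivity
  have h5 : 0 ≤ n * s * G := by positivity
  nlinarith

/-- The factor 15 is 1/2 + 3/2 + 13; the second bound uses (1/2 + 3/2)/20 + 13·0.002 ≤ 0.15. -/
theorem error_coefficient_le {L E ν₁ ν₂ ν₁₂ γ : ℝ} (hL : 2 * L ≤ E) (hL2 : 2 * L ^ 2 ≤ E)
    (hL3 : L ^ 3 ≤ E) (hν₁ : 0 ≤ ν₁) (hν₂ : 0 ≤ ν₂) (hν₁₂ : 0 ≤ ν₁₂)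
    (hLν₁ : L ^ 3 * ν₁ ≤ 2 / 1000) (hγ1 : E * ν₁ ^ 2 ≤ γ) (hγ2 : E * ν₂ ≤ γ)
    (hγ3 : E * ν₁₂ ≤ γ) (hEν₂ : E * ν₂ ≤ ν₁ / 20) (hEν₁₂ : E * ν₁₂ ≤ ν₁ / 20) :
    L * ν₂ + 3 * (L ^ 2 * ν₁₂) + 13 * (L ^ 3 * ν₁ ^ 2) ≤ 15 * γ ∧
      L * ν₂ + 3 * (L ^ 2 * ν₁₂) + 13 * (L ^ 3 * ν₁ ^ 2) ≤ 15 / 100 * ν₁ := by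
  have p1 : 2 * L * ν₂ ≤ E * ν₂ := mul_le_mul_of_nonneg_right hL hν₂
  have p2 : 2 * L ^ 2 * ν₁₂ ≤ E * ν₁₂ := mul_le_mul_of_nonneg_right hL2 hν₁₂
  have p3 : L ^ 3 * ν₁ ^ 2 ≤ E * ν₁ ^ 2 := by gcongr
  have p4 := mul_le_mul_of_nonneg_right hLν₁ hν₁
  constructor <;> linarith

theorem integrable_pow_sum_of_ae_le {Ω : Type*} [MeasurableSpace Ω] {P : Measure Ω}
    [IsFiniteMeasure P] {X : ℕ → Ω → ℕ} {n : ℕ} (hX : ∀ i ∈ Finset.Icc 1 n, Measurable (X i))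
    {C L r s : ℝ} (hC : ∀ i ∈ Finset.Icc 1 n, ∀ᵐ ω ∂P, (X i ω : ℝ) ≤ C) (hrs : |r| ≤ s)
    (hL : ∀ k : ℕ, (k : ℝ) ≤ C → s ^ k ≤ L) :
    Integrable (fun ω => r ^ (∑ i ∈ Finset.Icc 1 n, X i ω)) P := by
  have hall : ∀ᵐ ω ∂P, ∀ i ∈ Finset.Icc 1 n, (X i ω : ℝ) ≤ C := by
    rwa [Finset.eventually_all]
  refine Integrable.of_bound (C := L ^ n)
    ((Measurable.of_discrete (f := fun k : ℕ => r ^ k)).comp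
      (Finset.measurable_fun_sum _ hX)).aestronglyMeasurable ?_
  filter_upwards [hall] with ω hω
  rw [← Finset.prod_pow_eq_pow_sum, norm_prod]
  refine (Finset.prod_le_prod (g := fun _ => L) (fun i _ => norm_nonneg _)
    fun i hi => ?_).trans (by simp)
  rw [norm_pow, Real.norm_eq_abs]
  exact (pow_le_pow_left₀ (abs_nonneg r) hrs _).trans (hL _ (hω i hi))

theorem theorem1 :
    -- the constants are absolute: chosen before all other data
    ∃ C₁ C₂ : ℝ, 0 < C₁ ∧ 0 < C₂ ∧
      ∀ {Ω : Type*} [MeasurableSpace Ω] (P : Measure Ω) [IsProbabilityMeasure P]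
        (n : ℕ) (X : ℕ → Ω → ℕ) (x : ℕ) (C₀ ν₁ ν₂ ν₁₂ y γ : ℝ),
        2 ≤ n → 1 ≤ x → 1 ≤ C₀ →
        -- `X 1, …, X n` are identically distributed and 1-dependent
        (∀ i ∈ Finset.Icc 1 n, Measurable (X i)) →
        (∀ i ∈ Finset.Icc 1 n, IdentDistrib (X i) (X 1) P P) →
        IsMDependent 1 n X P →
        -- the moments `E X₁`, `E X₁ (X₁ - 1)`, `E X₁ X₂`
        ν₁ = ∫ ω, (X 1 ω : ℝ) ∂P →
        ν₂ = ∫ ω, (X 1 ω : ℝ) * ((X 1 ω : ℝ) - 1) ∂P →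
        ν₁₂ = ∫ ω, (X 1 ω : ℝ) * (X 2 ω : ℝ) ∂P →
        -- no adjacent pair has a larger mixed moment than the first one
        (∀ i : ℕ, 1 ≤ i → i + 1 ≤ n →
          ∫ ω, (X i ω : ℝ) * (X (i + 1) ω : ℝ) ∂P ≤ ν₁₂) →
        y = ((x : ℝ) - n * ν₁) / (n * ν₁) →
        γ = Real.exp (1.5 * C₀) * max (ν₁ ^ 2) (max ν₂ ν₁₂) →
        -- smallness and boundedness conditions
        0 < ν₁ →
        (∀ᵐ ω ∂P, (X 1 ω : ℝ) ≤ C₀) →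
        Real.exp (5 * C₀) * ν₁ ≤ 0.002 →
        |y| ≤ 1 / 10 →
        ν₂ ≤ ν₁ * Real.exp (-(1.5 * C₀)) / 20 →
        ν₁₂ ≤ ν₁ * Real.exp (-(1.5 * C₀)) / 20 →
        ∃ θ : ℝ, |θ| ≤ 1 ∧
          P.real {ω | ∑ i ∈ Finset.Icc 1 n, X i ω = x} /
              (poissonMeasure (Real.toNNReal (n * ν₁))).real {x} =
            Real.exp (cramerSeries n ν₁ y) * (1 + C₁ * γ * y ^ 2) ^ n *
              (1 + θ * C₂ * γ * (ν₁⁻¹ + n * y ^ 2)) := by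
  -- The constants of `abs_sub_correction_le`: 700 exceeds 600 + 41.
  refine ⟨40, 700, by norm_num, by norm_num, ?_⟩
  intro Ω _ P _ n X x C₀ ν₁ ν₂ ν₁₂ y γ hn hx hC₀ hX hid hdep hν₁ hν₂ hν₁₂ hadj hy hγ hν₁0 hC hsmall
    hy1 hν₂s hν₁₂s
  have hn0 : (2 : ℝ) ≤ n := by exact_mod_cast hn
  have hν₁₂0 : 0 ≤ ν₁₂ := by rw [hν₁₂]; positivity
  -- L dominates |z|^k for |z| ≤ 11/10 and k ≤ C₀, since 1.1 ≤ exp(0.1).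
  set L := Real.exp (C₀ / 10) with hL
  set E := Real.exp (1.5 * C₀) with hE
  have hL1 : 1 ≤ L := Real.one_le_exp (by linarith)
  have hL0 : 0 < L := by linarith
  have hE0 : 0 < E := Real.exp_pos _
  have hLpow : ∀ k : ℕ, (k : ℝ) ≤ C₀ → (11 / 10 : ℝ) ^ k ≤ L := fun k hk => by
    have h1 : (11 / 10 : ℝ) ≤ Real.exp (1 / 10) := by
      linarith [Real.add_one_le_exp (1 / 10 : ℝ)]
    calc (11 / 10 : ℝ) ^ k ≤ Real.exp (1 / 10) ^ k := by gcongr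
      _ = Real.exp (k * (1 / 10)) := by rw [Real.exp_nat_mul]
      _ ≤ L := Real.exp_le_exp.2 (by linarith)
  have hL2E : 2 * L ^ 2 ≤ E := by
    have h1 : 2 ≤ Real.exp (13 / 10 * C₀) := by
      linarith [Real.add_one_le_exp (13 / 10 * C₀)]
    have h2 : E = Real.exp (13 / 10 * C₀) * L ^ 2 := by
      rw [hE, hL, ← Real.exp_nat_mul, ← Real.exp_add]; congr 1; push_cast; ring
    rw [h2]; gcongr
  have hLL2 : L ≤ L ^ 2 := le_self_pow₀ hL1 (by norm_num)
  have hL3E : L ^ 3 ≤ E := by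
    rw [hE, hL, ← Real.exp_nat_mul]
    exact Real.exp_le_exp.2 (by push_cast; linarith)
  have hE5 : E ≤ Real.exp (5 * C₀) := Real.exp_le_exp.2 (by linarith)
  have hEν : E * ν₁ ≤ 2 / 1000 := by
    linarith [mul_le_mul_of_nonneg_right hE5 hν₁0.le]
  have hL3ν : L ^ 3 * ν₁ ≤ 2 / 1000 := (mul_le_mul_of_nonneg_right hL3E hν₁0.le).trans hEν
  have hE1 : 1 ≤ E := Real.one_le_exp (by linarith)
  have hν₁s : ν₁ ≤ 2 / 1000 := (le_mul_of_one_le_left hν₁0.le hE1).trans hEν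
  have hinv : Real.exp (-(1.5 * C₀)) * E = 1 := by
    rw [hE, ← Real.exp_add]; simp
  have hEν₂ : E * ν₂ ≤ ν₁ / 20 := by
    refine (mul_le_mul_of_nonneg_left hν₂s hE0.le).trans (le_of_eq ?_)
    linear_combination ν₁ / 20 * hinv
  have hEν₁₂ : E * ν₁₂ ≤ ν₁ / 20 := by
    refine (mul_le_mul_of_nonneg_left hν₁₂s hE0.le).trans (le_of_eq ?_)
    linear_combination ν₁ / 20 * hinv
  have hν₂0 : 0 ≤ ν₂ := hν₂ ▸ integral_nonneg fun ω => natCast_mul_sub_one_nonneg _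
  have hγ1 : E * ν₁ ^ 2 ≤ γ := by rw [hγ]; gcongr; exact le_max_left _ _
  have hγ2 : E * ν₂ ≤ γ := by
    rw [hγ]; gcongr; exact (le_max_left _ _).trans (le_max_right _ _)
  have hγ3 : E * ν₁₂ ≤ γ := by
    rw [hγ]; gcongr; exact (le_max_right _ _).trans (le_max_right _ _)
  have hγ0 : 0 < γ := lt_of_lt_of_le (by positivity) hγ1
  have hγν : γ ≤ ν₁ / 20 := by
    rw [hγ, mul_max_of_nonneg _ _ hE0.le, mul_max_of_nonneg _ _ hE0.le]
    exact max_le (by linarith [mul_le_mul_of_nonneg_left hEν hν₁0.le]) (max_le hEν₂ hEν₁₂)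
  have hL12 : 1 ≤ L ^ 2 := one_le_pow₀ hL1
  obtain ⟨hεγ, hεν⟩ := error_coefficient_le (by linarith) hL2E hL3E hν₁0.le hν₂0 hν₁₂0 hL3ν
    hγ1 hγ2 hγ3 hEν₂ hEν₁₂
  set ε := L * ν₂ + 3 * (L ^ 2 * ν₁₂) + 13 * (L ^ 3 * ν₁ ^ 2) with hε
  have hε0 : 0 ≤ ε := by positivity
  have hS : Measurable fun ω => ∑ i ∈ Finset.Icc 1 n, X i ω := Finset.measurable_fun_sum _ hX
  have hl : 0 < n * ν₁ := by positivity
  have hxl : (x : ℝ) = n * ν₁ * (1 + y) := by rw [hy]; field_simp; ring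
  have hint : Integrable (fun ω => (1 + y) ^ (∑ i ∈ Finset.Icc 1 n, X i ω)) P := by
    refine integrable_pow_sum_of_ae_le hX ?_ ?_ hLpow
    · exact fun i hi => (hid i hi).symm.ae_snd (p := fun k : ℕ => (k : ℝ) ≤ C₀)
        MeasurableSet.of_discrete hC
    · rw [abs_le]
      constructor <;> linarith only [(abs_le.1 hy1).1, (abs_le.1 hy1).2]
  have hmain := abs_measureReal_div_poisson_sub_one_le hS (by omega) hν₁0 hε0 hεν rfl hy1 hx hxl
    hint fun z hz => norm_integral_pow_sum_sub_exp_le hX (by omega) hid hdep hν₁ hν₂ hν₁₂0 hadj hC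
      hLpow hL1 hL3ν
      (by linarith only [hEν₁₂, mul_le_mul_of_nonneg_right hL2E hν₁₂0]) hz hε
  set R := P.real {ω | ∑ i ∈ Finset.Icc 1 n, X i ω = x} /
    (poissonMeasure (Real.toNNReal (n * ν₁))).real {x}
  have hny : 0 ≤ n * y ^ 2 := by positivity
  have hs : n * ε * y ^ 2 ≤ 15 * (n * (γ * y ^ 2)) := by
    linarith [mul_le_mul_of_nonneg_left hεγ hny]
  have hA : ε / ν₁ ≤ 15 * (γ * ν₁⁻¹) := by
    rw [div_eq_mul_inv, ← mul_assoc]; gcongr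
  have hA0 : 0 ≤ γ * ν₁⁻¹ := by positivity
  have hB0 : 0 ≤ n * (γ * y ^ 2) := by positivity
  -- Here (22/5)·8·15 = 528 ≤ 600 and 1.1·15 = 16.5 ≤ 19.
  have hR : |R - 1| ≤ 600 * (γ * ν₁⁻¹ + n * (γ * y ^ 2)) *
      Real.exp (19 * (n * (γ * y ^ 2))) := by
    refine hmain.trans (mul_le_mul ?_ (Real.exp_le_exp.2 (by linarith)) (Real.exp_pos _).le
      (by positivity))
    linarith
  have hΛ : |cramerSeries n ν₁ y| ≤ n * (γ * y ^ 2) := by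
    refine (abs_cramerSeries_le hν₁0.le (by linarith) (by linarith)).trans ?_
    have h2E : 2 * ν₁ ^ 2 ≤ γ := le_trans (by gcongr; linarith only [hL12, hL2E]) hγ1
    linarith [mul_le_mul_of_nonneg_left h2E hny]
  have hy2 : y ^ 2 ≤ 1 := (sq_le_one_iff_abs_le_one y).2 (hy1.trans (by norm_num))
  have hfin := abs_sub_correction_le (R := R) (n := n) (s := γ * y ^ 2) (by positivity)
    (by linarith [mul_le_mul_of_nonneg_left hy2 hγ0.le]) hΛ hA0 hR
  obtain ⟨θ, hθ, hEq⟩ := exists_theta_of_abs_sub_le (by positivity) (by positivity) hfin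
  refine ⟨θ, hθ, hEq.trans ?_⟩
  rw [← mul_assoc 40 γ]
  ring
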